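/- Notation. Let $\mathcal H=(C,F,D,G)$ be a hybrid system on $\mathbb R^n$ ($\dot x\in F(x)$ for $x\in C$; $x^+\in G(x)$ for $x\in D$) with set-valued maps $F,G:\mathbb R^n\rightrightarrows\mathbb R^n$, satisfying the basic conditions: $C,D$ are closed; $F$ is outer semicontinuous and locally bounded relative to $C$, with $F(x)$ convex for $x\in C$; $G$ is outer semicontinuous and locally bounded relative to $D$. With $\mathbb B$ the closed Euclidean unit ball and $\delta\ge 0$, $\mathcal H_\delta$ is the system with flow set $C_\delta=C+\delta\mathbb B$, flow map $F(x)+\delta\mathbb B$, jump set $D_\delta=D+\delta\mathbb B$, jump map $G(x)+\delta\mathbb B$. A hybrid time domain is a union of sets $[t_j,t_{j+1}]\times\{j\}$, $0=t_0\le t_1\le\dots$, over all $j\in\mathbb N$ or over $j=0,\dots,J$, where in the latter case the last interval may also be $[t_J,T)$ with $t_J<T\le\infty$. A hybrid arc $\phi$ is an $\mathbb R^n$-valued function on a hybrid time domain with $\phi(\cdot,j)$ locally absolutely continuous on $I^j=\{t:(t,j)\in\operatorname{dom}\phi\}$ for each $j$. It is a solution of $(C,F,D,G)$ if $\phi(0,0)\in\overline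 C\cup D$; $\phi(t,j)\in C$ for all $t\in\operatorname{int}I^j$ and $\dot\phi(t,j)\in F(\phi(t,j))$ for almost all $t\in I^j$ whenever $\operatorname{int}I^j\ne\emptyset$; and $\phi(t,j)\in D$, $\phi(t,j+1)\in G(\phi(t,j))$ whenever $(t,j),(t,j+1)\in\operatorname{dom}\phi$. It is maximal if no solution on a strictly larger domain extends it, complete if its domain is unbounded, bounded if its range is bounded. Write $|x|_A=\inf_{y\in A}|x-y|$, with $|x|_\emptyset=+\infty$. $\mathcal H_\delta$ satisfies the reach-avoid-stay specification $(\mathcal X_0,U,\mathfrak I)$ if (i) there is $T\ge0$ such that $\phi(t,j)\in\mathfrak I$ for every maximal solution $\phi$ of $\mathcal H_\delta$ with $\phi(0,0)\in\mathcal X_0$ and all $(t,j)\in\operatorname{dom}\phi$ with $t+j\ge T$, and (ii) no maximal solution of $\mathcal H_\delta$ starting in $\mathcal X_0$ meets $U$. A closed set $A$ is uniformly pre-asymptotically stable for $\mathcal H_\delta$ if for every $\varepsilon>0$ there is $\eta>0$ such that every solution with $|\phi(0,0)|_A<\eta$ has $|\phi(t,j)|_A<\varepsilon$ on $\operatorname{dom}\phi$;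 and there is $\rho>0$ such that for every $\varepsilon>0$ there is $T>0$ such that every solution with $|\phi(0,0)|_A<\rho$ has $|\phi(t,j)|_A<\varepsilon$ for all $(t,j)\in\operatorname{dom}\phi$ with $t+j\ge T$. The basin of pre-attraction of $A$ is the set of $x$ such that every solution with $\phi(0,0)=x$ is bounded and, if complete, satisfies $|\phi(t,j)|_A\to0$ as $t+j\to\infty$. $\mathcal H_\delta$ satisfies the stability-with-safety specification $(\mathcal X_0,U,A)$ if $A$ is closed and uniformly pre-asymptotically stable for $\mathcal H_\delta$, $\mathcal X_0$ is contained in its basin of pre-attraction, and no maximal solution of $\mathcal H_\delta$ starting in $\mathcal X_0$ meets $U$. A set-valued map $M$ is locally Lipschitz on an open set $\mathcal O$ if each $x\in\mathcal O$ has a neighborhood $\mathcal N\subseteq\mathcal O$ and an $L>0$ with $M(x_1)\subseteq M(x_2)+L|x_2-x_1|\mathbb B$ for all $x_1,x_2\in\mathcal N$. Proposition. Let $\delta\ge0$, and let $F$ and $G$ be locally Lipschitz on some open set containing $C_\delta$ and on some open set containing $D_\delta$, respectively. Let $\mathcal X_0,U,\mathfrak I\subseteq\mathbb R^n$ with $\mathcal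 X_0$ nonempty and $\mathfrak I$ compact. Assume that every maximal solution of $\mathcal H_\delta$ starting in $\mathcal X_0$ is bounded or complete (that is, none of them escapes to infinity in finite time). If $\mathcal H_\delta$ satisfies the reach-avoid-stay specification $(\mathcal X_0,U,\mathfrak I)$, then there is a compact set $A\subseteq\mathfrak I$ such that, for every $\delta'\in[0,\delta)$, $\mathcal H_{\delta'}$ satisfies the stability-with-safety specification $(\mathcal X_0,U,A)$. -/

import Mathlib

open Set Filter Topology MeasureTheory
open scoped Pointwise

/-- The state space `ℝⁿ` with its Euclidean norm. -/
abbrev State (n : ℕ) := EuclideanSpace ℝ (Fin n)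

/-- Data `(C, F, D, G)` of a hybrid system: `ẋ ∈ F x` for `x ∈ C`, `x⁺ ∈ G x` for `x ∈ D`. -/
structure HybridSystem (n : ℕ) where
  C : Set (State n)
  F : State n → Set (State n)
  D : Set (State n)
  G : State n → Set (State n)

/-- Outer semicontinuity of a set-valued map at the points of `S`, relative to `S`. -/
def OuterSemicontOn {n : ℕ} (M : State n → Set (State n)) (S : Set (State n)) : Prop :=
  ∀ x ∈ S, ∀ (u v : ℕ → State n) (y : State n),
    (∀ i, u i ∈ S) → (∀ i, v i ∈ M (u i)) →
      Tendsto u atTop (𝓝 x) → Tendsto v atTop (𝓝 y) → y ∈ M x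

/-- Local boundedness of a set-valued map at the points of `S`, relative to `S`. -/
def LocallyBddOn {n : ℕ} (M : State n → Set (State n)) (S : Set (State n)) : Prop :=
  ∀ x ∈ S, ∃ N ∈ 𝓝 x, Bornology.IsBounded (⋃ z ∈ N ∩ S, M z)

/-- A set-valued map is locally Lipschitz on (the open set) `O`. -/
def SetValuedLocallyLipschitzOn {n : ℕ} (M : State n → Set (State n)) (O : Set (State n)) :
    Prop :=
  ∀ x ∈ O, ∃ N ∈ 𝓝 x, N ⊆ O ∧ ∃ L : ℝ, 0 < L ∧
    ∀ x₁ ∈ N, ∀ x₂ ∈ N, M x₁ ⊆ M x₂ + Metric.closedBall 0 (L * ‖x₂ - x₁‖)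

/-- Hybrid time domains: `⋃_{j} [t_j, t_{j+1}] × {j}` with `0 = t₀ ≤ t₁ ≤ …`, over all `j`, or
over finitely many `j ≤ J`, where the last interval may be any interval with least element `t_J`
(that is `[t_J, T]`, `[t_J, T)` or `[t_J, ∞)`). -/
def IsHybridTimeDomain (E : Set (ℝ × ℕ)) : Prop :=
  ∃ t : ℕ → ℝ, t 0 = 0 ∧ Monotone t ∧
    (E = {p | p.1 ∈ Icc (t p.2) (t (p.2 + 1))} ∨
      ∃ (J : ℕ) (I : Set ℝ), IsLeast I (t J) ∧ I.OrdConnected ∧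
        E = {p | p.2 < J ∧ p.1 ∈ Icc (t p.2) (t (p.2 + 1))} ∪ {p | p.2 = J ∧ p.1 ∈ I})

/-- Hybrid arcs. The values of `val` outside `dom` are irrelevant. -/
structure HybridArc (n : ℕ) where
  dom : Set (ℝ × ℕ)
  val : ℝ → ℕ → State n
  isDomain : IsHybridTimeDomain dom
  locallyAC : ∀ (j : ℕ) (a b : ℝ), a ≤ b → (∀ t ∈ Icc a b, (t, j) ∈ dom) →
    AbsolutelyContinuousOnInterval (fun t => val t j) a b

namespace HybridArc

variable {n : ℕ}

/-- The interval `I^j = {t : (t, j) ∈ dom φ}`. -/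
def slice (φ : HybridArc n) (j : ℕ) : Set ℝ := {t | (t, j) ∈ φ.dom}

/-- The range of a hybrid arc. -/
def rge (φ : HybridArc n) : Set (State n) := {x | ∃ t j, (t, j) ∈ φ.dom ∧ φ.val t j = x}

/-- An arc is bounded if its range is. -/
def IsBdd (φ : HybridArc n) : Prop := Bornology.IsBounded φ.rge

/-- An arc is complete if its domain is unbounded. -/
def IsComplete (φ : HybridArc n) : Prop := ∀ T : ℝ, ∃ t j, (t, j) ∈ φ.dom ∧ T ≤ t + (j : ℝ)

/-- `|φ(t,j)|_A → 0` as `t + j → ∞`; the distance to the empty set is `∞`. -/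
def ConvergesTo (φ : HybridArc n) (A : Set (State n)) : Prop :=
  ∀ ε : ℝ, 0 < ε → ∃ T : ℝ, ∀ t j, (t, j) ∈ φ.dom → T ≤ t + (j : ℝ) →
    Metric.infEDist (φ.val t j) A < ENNReal.ofReal ε

end HybridArc

namespace HybridSystem

variable {n : ℕ}

/-- The standing basic conditions (C1)-(C3). -/
structure BasicConditions (H : HybridSystem n) : Prop where
  isClosed_C : IsClosed H.C
  isClosed_D : IsClosed H.D
  osc_F : OuterSemicontOn H.F H.C
  bdd_F : LocallyBddOn H.F H.C
  convex_F : ∀ x ∈ H.C, Convex ℝ (H.F x)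
  osc_G : OuterSemicontOn H.G H.D
  bdd_G : LocallyBddOn H.G H.D

/-- The additive `δ`-perturbation `H_δ`. -/
def perturb (H : HybridSystem n) (δ : ℝ) : HybridSystem n where
  C := H.C + Metric.closedBall 0 δ
  F := fun x => H.F x + Metric.closedBall 0 δ
  D := H.D + Metric.closedBall 0 δ
  G := fun x => H.G x + Metric.closedBall 0 δ

/-- Solutions of a hybrid system. -/
structure IsSolution (H : HybridSystem n) (φ : HybridArc n) : Prop where
  init : φ.val 0 0 ∈ closure H.C ∪ H.D
  flow_mem : ∀ j, ∀ t ∈ interior (φ.slice j), φ.val t j ∈ H.C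
  flow_deriv : ∀ j, ∀ᵐ t : ℝ, t ∈ interior (φ.slice j) →
    ∃ v ∈ H.F (φ.val t j), HasDerivAt (fun s => φ.val s j) v t
  jump : ∀ t j, (t, j) ∈ φ.dom → (t, j + 1) ∈ φ.dom →
    φ.val t j ∈ H.D ∧ φ.val t (j + 1) ∈ H.G (φ.val t j)

/-- Maximal solutions: those with no extension to a solution on a strictly larger domain. -/
def IsMaximalSolution (H : HybridSystem n) (φ : HybridArc n) : Prop :=
  H.IsSolution φ ∧ ¬ ∃ ψ : HybridArc n, H.IsSolution ψ ∧ φ.dom ⊂ ψ.dom ∧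
    ∀ t j, (t, j) ∈ φ.dom → φ.val t j = ψ.val t j

/-- The set of maximal solutions starting from `K`. -/
def maximalSolutions (H : HybridSystem n) (K : Set (State n)) : Set (HybridArc n) :=
  {φ | H.IsMaximalSolution φ ∧ φ.val 0 0 ∈ K}

/-- The reachable set from `K` at hybrid times `t + j ≥ T`. -/
def reachGE (H : HybridSystem n) (T : ℝ) (K : Set (State n)) : Set (State n) :=
  {x | ∃ φ ∈ H.maximalSolutions K, ∃ t j, (t, j) ∈ φ.dom ∧ T ≤ t + (j : ℝ) ∧ φ.val t j = x}

/-- Safety: the maximal solutions from `X₀` never meet `U`. -/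
def Safe (H : HybridSystem n) (X₀ U : Set (State n)) : Prop :=
  ∀ φ ∈ H.maximalSolutions X₀, φ.rge ∩ U = ∅

/-- The reach-avoid-stay specification `(X₀, U, I)`. -/
def ReachAvoidStay (H : HybridSystem n) (X₀ U I : Set (State n)) : Prop :=
  (∃ T : ℝ, 0 ≤ T ∧ H.reachGE T X₀ ⊆ I) ∧ H.Safe X₀ U

/-- Uniform pre-asymptotic stability of the closed set `A`. -/
structure UpAS (H : HybridSystem n) (A : Set (State n)) : Prop where
  isClosed : IsClosed A
  stable : ∀ ε : ℝ, 0 < ε → ∃ η : ℝ, 0 < η ∧ ∀ φ : HybridArc n, H.IsSolution φ →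
    Metric.infEDist (φ.val 0 0) A < ENNReal.ofReal η →
      ∀ t j, (t, j) ∈ φ.dom → Metric.infEDist (φ.val t j) A < ENNReal.ofReal ε
  attractive : ∃ ρ : ℝ, 0 < ρ ∧ ∀ ε : ℝ, 0 < ε → ∃ T : ℝ, 0 < T ∧
    ∀ φ : HybridArc n, H.IsSolution φ →
      Metric.infEDist (φ.val 0 0) A < ENNReal.ofReal ρ →
        ∀ t j, (t, j) ∈ φ.dom → T ≤ t + (j : ℝ) →
          Metric.infEDist (φ.val t j) A < ENNReal.ofReal ε

/-- The basin of pre-attraction of `A`. -/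
def basin (H : HybridSystem n) (A : Set (State n)) : Set (State n) :=
  {x | ∀ φ : HybridArc n, H.IsSolution φ → φ.val 0 0 = x →
    φ.IsBdd ∧ (φ.IsComplete → φ.ConvergesTo A)}

/-- The stability with safety guarantee specification `(X₀, U, A)`. -/
def StableSafe (H : HybridSystem n) (X₀ U A : Set (State n)) : Prop :=
  (H.UpAS A ∧ X₀ ⊆ H.basin A) ∧ H.Safe X₀ U

end HybridSystem

/-! Let `S` be the set of points of `I` from which no solution of the `δ`-system ever leaves `I`;
the attractor is `A = closure S`. Concatenating solutions shows that `S` is forward invariant for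
the `δ`-system (`mem_stayingSet`) and that every solution from `X₀` lies in `S` from time `T` on
(`mem_stayingSet_of_reach`).

Stability comes from the gap between `δ'` and `δ`. Given a solution `φ` of the `δ'`-system starting
close to `x ∈ S`, add to it `d = x - φ(0,0)` times a weight that falls from 1 to 0 during the first
unit of flow and vanishes after any jump. By the Lipschitz property this changes the inclusions by
at most `(L + 1) * ‖d‖ ≤ δ - δ'`, so the steered arc solves the `δ`-system and stays in `S`
(`exists_steering_radius`). It is always within `‖d‖` of `φ` and equals `φ` once `t + j ≥ 1`. Hence
solutions starting near `A` stay near it and are in it after one unit of hybrid time. Passing to the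
closure costs nothing, since distances to `S` and to its closure agree.

Solutions of the `δ'`-system also solve the `δ`-system, and every solution extends to a maximal one
(`exists_maximal`); this transfers safety, boundedness and convergence. -/

/-! ### Absolute continuity: reparametrization and gluing -/

namespace AbsolutelyContinuousOnInterval

theorem congr_uIcc {X : Type*} [PseudoMetricSpace X] {f g : ℝ → X} {a b : ℝ}
    (hf : AbsolutelyContinuousOnInterval f a b) (h : EqOn f g (uIcc a b)) :
    AbsolutelyContinuousOnInterval g a b := by
  rw [absolutelyContinuousOnInterval_iff] at hf ⊢
  intro ε hε
  obtain ⟨η, hη, H⟩ := hf ε hε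
  refine ⟨η, hη, fun E hE hlen => ?_⟩
  refine lt_of_eq_of_lt (Finset.sum_congr rfl fun i hi => ?_) (H E hE hlen)
  rw [h (hE.1 i hi).1, h (hE.1 i hi).2]

/-- Precomposition with a monotone nonexpanding map preserves absolute continuity. -/
theorem comp_monotone {X : Type*} [PseudoMetricSpace X] {f : ℝ → X} {p : ℝ → ℝ} {a b c d : ℝ}
    (hf : AbsolutelyContinuousOnInterval f c d) (hp : Monotone p)
    (hdist : ∀ x y, dist (p x) (p y) ≤ dist x y) (hmaps : ∀ x ∈ uIcc a b, p x ∈ uIcc c d) :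
    AbsolutelyContinuousOnInterval (fun t => f (p t)) a b := by
  rw [absolutelyContinuousOnInterval_iff] at hf ⊢
  intro ε hε
  obtain ⟨η, hη, H⟩ := hf ε hε
  refine ⟨η, hη, fun E hE hlen => ?_⟩
  refine H (E.1, fun i => (p (E.2 i).1, p (E.2 i).2)) ⟨fun i hi => ?_, fun i hi j hj hij => ?_⟩ ?_
  · exact ⟨hmaps _ (hE.1 i hi).1, hmaps _ (hE.1 i hi).2⟩
  · have hdisj := hE.2 hi hj hij
    have key : ∀ {x y z : ℝ}, z ∈ uIoc (p x) (p y) → p (min x y) < z ∧ z ≤ p (max x y) := by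
      intro x y z hz
      rw [uIoc, mem_Ioc, ← hp.map_min, ← hp.map_max] at hz
      exact hz
    refine Set.disjoint_left.2 fun z hz hz' => ?_
    obtain ⟨h1, h2⟩ := key hz
    obtain ⟨h3, h4⟩ := key hz'
    have o1 := hp.reflect_lt (h1.trans_le h2)
    have o2 := hp.reflect_lt (h1.trans_le h4)
    have o3 := hp.reflect_lt (h3.trans_le h2)
    have o4 := hp.reflect_lt (h3.trans_le h4)
    -- If the image intervals share a point, the original ones overlap: the smaller of their right
    -- ends lies in both.
    have m : min (max (E.2 i).1 (E.2 i).2) (max (E.2 j).1 (E.2 j).2) ∈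
        uIoc (E.2 i).1 (E.2 i).2 := ⟨lt_min o1 o2, min_le_left _ _⟩
    exact Set.disjoint_left.1 hdisj m ⟨lt_min o3 o4, min_le_right _ _⟩
  · exact (Finset.sum_le_sum fun i _ => hdist _ _).trans_lt hlen

theorem comp_sub_const {X : Type*} [PseudoMetricSpace X] {f : ℝ → X} {a b c : ℝ}
    (hf : AbsolutelyContinuousOnInterval f (a - c) (b - c)) :
    AbsolutelyContinuousOnInterval (fun t => f (t - c)) a b := by
  refine hf.comp_monotone (fun x y h => by linarith) (fun x y => by simp) fun x hx => ?_
  rw [← Set.image_sub_const_uIcc]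
  exact ⟨x, hx, rfl⟩

/-- On `[a, b]`, `f t = f (min t c) + f (max t c) - f c`, and each term is absolutely continuous. -/
theorem trans {E : Type*} [NormedAddCommGroup E] {f : ℝ → E} {a b c : ℝ}
    (hac : a ≤ c) (hcb : c ≤ b)
    (h₁ : AbsolutelyContinuousOnInterval f a c) (h₂ : AbsolutelyContinuousOnInterval f c b) :
    AbsolutelyContinuousOnInterval f a b := by
  have e₁ : AbsolutelyContinuousOnInterval (fun t => f (min t c)) a b := by
    refine h₁.comp_monotone (fun x y h => min_le_min_right c h) (fun x y => ?_) fun x hx => ?_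
    · simpa [Real.dist_eq] using abs_min_sub_min_le_max x c y c
    · rw [uIcc_of_le (hac.trans hcb)] at hx
      rw [uIcc_of_le hac]
      exact ⟨le_min hx.1 hac, min_le_right _ _⟩
  have e₂ : AbsolutelyContinuousOnInterval (fun t => f (max t c)) a b := by
    refine h₂.comp_monotone (fun x y h => max_le_max_right c h) (fun x y => ?_) fun x hx => ?_
    · simpa [Real.dist_eq] using abs_max_sub_max_le_max x c y c
    · rw [uIcc_of_le (hac.trans hcb)] at hx
      rw [uIcc_of_le hcb]
      exact ⟨le_max_right _ _, max_le hx.2 hcb⟩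
  have e₃ : AbsolutelyContinuousOnInterval (fun _ : ℝ => f c) a b :=
    ((LipschitzWith.const (f c)).lipschitzOnWith).absolutelyContinuousOnInterval
  refine ((e₁.add e₂).sub e₃).congr_uIcc fun t _ => ?_
  rcases le_total t c with h | h <;> simp [h]

end AbsolutelyContinuousOnInterval

/-! ### Hybrid time domains through their slices -/

/-- A description of hybrid time domains through their slices. -/
theorem isHybridTimeDomain_iff {E : Set (ℝ × ℕ)} :
    IsHybridTimeDomain E ↔ IsLeast {t | (t, 0) ∈ E} 0 ∧
      (∀ j, OrdConnected {t | (t, j) ∈ E}) ∧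
      ∀ j s, (s, j + 1) ∈ E →
        ∃ r, IsGreatest {t | (t, j) ∈ E} r ∧ IsLeast {t | (t, j + 1) ∈ E} r := by
  constructor
  · rintro ⟨t, ht0, htm, rfl | ⟨J, I, hI, hIc, rfl⟩⟩
    · refine ⟨?_, fun j => ?_, fun j s _ => ⟨t (j + 1), ?_, ?_⟩⟩
      · exact ht0 ▸ (isLeast_Icc (htm (Nat.le_succ 0)) : IsLeast (Icc (t 0) (t 1)) (t 0))
      · exact (ordConnected_Icc : (Icc (t j) (t (j + 1))).OrdConnected)
      · exact isGreatest_Icc (htm (Nat.le_succ j))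
      · exact isLeast_Icc (htm (Nat.le_succ (j + 1)))
    · have hlt : ∀ j < J, {s | (s, j) ∈ {p : ℝ × ℕ | p.2 < J ∧ p.1 ∈ Icc (t p.2) (t (p.2 + 1))} ∪
          {p | p.2 = J ∧ p.1 ∈ I}} = Icc (t j) (t (j + 1)) := by
        intro j hj
        ext s
        simp [hj, hj.ne]
      have heq : {s | (s, J) ∈ {p : ℝ × ℕ | p.2 < J ∧ p.1 ∈ Icc (t p.2) (t (p.2 + 1))} ∪
          {p | p.2 = J ∧ p.1 ∈ I}} = I := by
        ext s
        simp
      have hgt : ∀ j, J < j → {s | (s, j) ∈ {p : ℝ × ℕ | p.2 < J ∧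
          p.1 ∈ Icc (t p.2) (t (p.2 + 1))} ∪ {p | p.2 = J ∧ p.1 ∈ I}} = ∅ := by
        intro j hj
        ext s
        simp [hj.ne', hj.not_gt]
      have hle : ∀ j ≤ J, IsLeast {s | (s, j) ∈ {p : ℝ × ℕ | p.2 < J ∧
          p.1 ∈ Icc (t p.2) (t (p.2 + 1))} ∪ {p | p.2 = J ∧ p.1 ∈ I}} (t j) := by
        intro j hj
        rcases hj.lt_or_eq with h | rfl
        · rw [hlt j h]
          exact isLeast_Icc (htm (Nat.le_succ j))
        · rwa [heq]
      refine ⟨ht0 ▸ hle 0 (Nat.zero_le _), fun j => ?_, fun j s hs => ?_⟩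
      · rcases lt_trichotomy j J with h | rfl | h
        · rw [hlt j h]
          exact ordConnected_Icc
        · rwa [heq]
        · rw [hgt j h]
          exact ordConnected_empty
      · have hj : j + 1 ≤ J := by
          by_contra! h
          have : s ∈ (∅ : Set ℝ) := hgt _ h ▸ hs
          exact this
        refine ⟨t (j + 1), ?_, hle _ hj⟩
        rw [hlt j hj]
        exact isGreatest_Icc (htm (Nat.le_succ j))
  · rintro ⟨h0, hc, hs⟩
    classical
    choose! r hr using hs
    have hg : ∀ j s, (s, j + 1) ∈ E → ∃ q, IsGreatest {t | (t, j) ∈ E} q ∧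
        IsLeast {t | (t, j + 1) ∈ E} q := fun j s h => ⟨_, hr j s h⟩
    have hl : ∀ j, ∃ a : ℝ, ∀ s, (s, j) ∈ E → IsLeast {t | (t, j) ∈ E} a := by
      intro j
      cases j with
      | zero => exact ⟨0, fun _ _ => h0⟩
      | succ j =>
        by_cases h : ∃ s, (s, j + 1) ∈ E
        · obtain ⟨s, hs⟩ := h
          exact ⟨_, fun _ _ => (hr j s hs).2⟩
        · exact ⟨0, fun s hs => (h ⟨s, hs⟩).elim⟩
    choose a ha using hl
    have hstep : ∀ j s, (s, j + 1) ∈ E → IsGreatest {t | (t, j) ∈ E} (a (j + 1)) := by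
      intro j s hs
      obtain ⟨q, hq1, hq2⟩ := hg j s hs
      rwa [(ha _ _ hs).unique hq2]
    have hIcc : ∀ j s, (s, j + 1) ∈ E → {t | (t, j) ∈ E} = Icc (a j) (a (j + 1)) := by
      intro j s hs
      have h1 := hstep j s hs
      have h2 := ha j _ h1.1
      exact Subset.antisymm (fun x hx => ⟨h2.2 hx, h1.2 hx⟩) ((hc j).out h2.1 h1.1)
    have ha0 : a 0 = 0 := (ha 0 0 h0.1).unique h0
    by_cases hall : ∀ j, ∃ s, (s, j) ∈ E
    · refine ⟨a, ha0, monotone_nat_of_le_succ fun j => ?_, Or.inl ?_⟩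
      · obtain ⟨s, hs⟩ := hall (j + 1)
        have := hstep j s hs
        exact (ha j _ this.1).2 this.1
      · ext ⟨s, j⟩
        obtain ⟨s', hs'⟩ := hall (j + 1)
        exact Set.ext_iff.1 (hIcc j s' hs') s
    · have hall' : ∃ j, ∀ s, (s, j) ∉ E := by simpa using hall
      obtain ⟨J, hJ⟩ : ∃ J, Nat.find hall' = J + 1 := by
        refine Nat.exists_eq_succ_of_ne_zero fun h => ?_
        have := Nat.find_spec hall'
        rw [h] at this
        exact this 0 h0.1
      have hne : ∀ j ≤ J, ∃ s, (s, j) ∈ E := by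
        intro j hj
        have := Nat.find_min hall' (m := j) (by omega)
        simpa using this
      have hemp : ∀ j, J + 1 ≤ j → ∀ s, (s, j) ∉ E := by
        intro j hj
        induction j, hj using Nat.le_induction with
        | base => exact hJ ▸ Nat.find_spec hall'
        | succ j _ ih => exact fun s hs => ih _ (hstep j s hs).1
      refine ⟨fun j => a (min j J), by simpa using ha0, monotone_nat_of_le_succ fun j => ?_,
        Or.inr ⟨J, {t | (t, J) ∈ E}, ?_, hc J, ?_⟩⟩
      · rcases lt_or_ge j J with h | h
        · obtain ⟨s, hs⟩ := hne (j + 1) h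
          have := hstep j s hs
          rw [min_eq_left h.le, min_eq_left (Nat.succ_le_of_lt h)]
          exact (ha j _ this.1).2 this.1
        · rw [min_eq_right h, min_eq_right (h.trans (Nat.le_succ j))]
      · obtain ⟨s, hs⟩ := hne J le_rfl
        simpa using ha J s hs
      · ext ⟨s, j⟩
        rcases lt_trichotomy j J with h | rfl | h
        · obtain ⟨s', hs'⟩ := hne (j + 1) h
          have := Set.ext_iff.1 (hIcc j s' hs') s
          have e : j + 1 ≤ J := h
          simpa [h, h.ne, h.le, e] using this
        · simp
        · simp [h.ne', h.not_gt, hemp j h s]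

/-! ### Extension of arcs and unions of chains -/

namespace HybridArc

variable {n : ℕ}

theorem isLeast_slice_zero (φ : HybridArc n) : IsLeast (φ.slice 0) 0 :=
  (isHybridTimeDomain_iff.1 φ.isDomain).1

theorem zero_mem_dom (φ : HybridArc n) : ((0 : ℝ), 0) ∈ φ.dom := φ.isLeast_slice_zero.1

theorem ordConnected_slice (φ : HybridArc n) (j : ℕ) : (φ.slice j).OrdConnected :=
  (isHybridTimeDomain_iff.1 φ.isDomain).2.1 j

theorem exists_jump_time (φ : HybridArc n) {j : ℕ} {s : ℝ} (h : (s, j + 1) ∈ φ.dom) :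
    ∃ r, IsGreatest (φ.slice j) r ∧ IsLeast (φ.slice (j + 1)) r :=
  (isHybridTimeDomain_iff.1 φ.isDomain).2.2 j s h

/-- `ψ` extends `φ`. -/
def Extends (φ ψ : HybridArc n) : Prop :=
  φ.dom ⊆ ψ.dom ∧ ∀ t j, (t, j) ∈ φ.dom → φ.val t j = ψ.val t j

theorem Extends.refl (φ : HybridArc n) : φ.Extends φ := ⟨Subset.rfl, fun _ _ _ => rfl⟩

theorem Extends.trans {φ ψ χ : HybridArc n} (h : φ.Extends ψ) (h' : ψ.Extends χ) :
    φ.Extends χ :=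
  ⟨h.1.trans h'.1, fun t j m => (h.2 t j m).trans (h'.2 t j (h.1 m))⟩

theorem Extends.val_zero {φ ψ : HybridArc n} (h : φ.Extends ψ) : ψ.val 0 0 = φ.val 0 0 :=
  (h.2 0 0 φ.zero_mem_dom).symm

theorem chain_common {c : Set (HybridArc n)} (hc : IsChain Extends c) {p q : ℝ × ℕ}
    (hp : p ∈ ⋃ φ ∈ c, φ.dom) (hq : q ∈ ⋃ φ ∈ c, φ.dom) :
    ∃ φ ∈ c, p ∈ φ.dom ∧ q ∈ φ.dom := by
  simp only [mem_iUnion, exists_prop] at hp hq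
  obtain ⟨φ, hφ, hpφ⟩ := hp
  obtain ⟨ψ, hψ, hqψ⟩ := hq
  rcases eq_or_ne φ ψ with rfl | hne
  · exact ⟨φ, hφ, hpφ, hqψ⟩
  · rcases hc hφ hψ hne with h | h
    · exact ⟨ψ, hψ, h.1 hpφ, hqψ⟩
    · exact ⟨φ, hφ, hpφ, h.1 hqψ⟩

theorem chain_val_eq {c : Set (HybridArc n)} (hc : IsChain Extends c) {φ ψ : HybridArc n}
    (hφ : φ ∈ c) (hψ : ψ ∈ c) {t : ℝ} {j : ℕ} (h : (t, j) ∈ φ.dom) (h' : (t, j) ∈ ψ.dom) :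
    φ.val t j = ψ.val t j := by
  rcases eq_or_ne φ ψ with rfl | hne
  · rfl
  · rcases hc hφ hψ hne with e | e
    · exact e.2 t j h
    · exact (e.2 t j h').symm

/-- The union of a nonempty chain of hybrid arcs. -/
theorem exists_chain_union {c : Set (HybridArc n)} (hc : IsChain Extends c) (hne : c.Nonempty) :
    ∃ ω : HybridArc n, ω.dom = (⋃ φ ∈ c, φ.dom) ∧ ∀ φ ∈ c, φ.Extends ω := by
  classical
  let v : ℝ → ℕ → State n := fun t j =>
    if h : ∃ φ ∈ c, (t, j) ∈ φ.dom then h.choose.val t j else 0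
  have hv : ∀ φ ∈ c, ∀ t j, (t, j) ∈ φ.dom → φ.val t j = v t j := by
    intro φ hφ t j h
    have hex : ∃ φ ∈ c, (t, j) ∈ φ.dom := ⟨φ, hφ, h⟩
    simp only [v, dif_pos hex]
    exact chain_val_eq hc hφ hex.choose_spec.1 h hex.choose_spec.2
  have hsub : ∀ φ ∈ c, φ.dom ⊆ ⋃ φ ∈ c, φ.dom := fun φ hφ => subset_biUnion_of_mem hφ
  refine ⟨⟨⋃ φ ∈ c, φ.dom, v, ?_, ?_⟩, rfl, fun φ hφ => ⟨hsub φ hφ, hv φ hφ⟩⟩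
  · refine isHybridTimeDomain_iff.2 ⟨⟨?_, ?_⟩, fun j => ⟨?_⟩, ?_⟩
    · obtain ⟨φ, hφ⟩ := hne
      exact hsub φ hφ φ.zero_mem_dom
    · intro t ht
      obtain ⟨φ, hφ, h, -⟩ := chain_common hc ht ht
      exact φ.isLeast_slice_zero.2 h
    · intro a ha b hb t ht
      obtain ⟨φ, hφ, h1, h2⟩ := chain_common hc ha hb
      exact hsub φ hφ ((φ.ordConnected_slice j).out h1 h2 ht)
    · intro j s hs
      obtain ⟨φ, hφ, h, -⟩ := chain_common hc hs hs
      obtain ⟨r, hr1, hr2⟩ := φ.exists_jump_time h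
      -- A member that extends `φ` also jumps from `j` to `j + 1`, necessarily at the same time `r`;
      -- any other member is contained in `φ`. Either way `r` separates the two slices.
      have key : ∀ ψ ∈ c, IsGreatest (ψ.slice j) r ∧ IsLeast (ψ.slice (j + 1)) r ∨
          ψ.Extends φ := by
        intro ψ hψ
        rcases eq_or_ne φ ψ with rfl | hne
        · exact Or.inr (Extends.refl _)
        · rcases hc hφ hψ hne with e | e
          · obtain ⟨r', h1, h2⟩ := ψ.exists_jump_time (e.1 h)
            have : r' = r := le_antisymm (h2.2 (e.1 hr2.1)) (h1.2 (e.1 hr1.1))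
            exact Or.inl (this ▸ ⟨h1, h2⟩)
          · exact Or.inr e
      refine ⟨r, ⟨hsub φ hφ hr1.1, fun t ht => ?_⟩, hsub φ hφ hr2.1, fun t ht => ?_⟩
      · obtain ⟨ψ, hψ, h', -⟩ := chain_common hc ht ht
        rcases key ψ hψ with e | e
        · exact e.1.2 h'
        · exact hr1.2 (e.1 h')
      · obtain ⟨ψ, hψ, h', -⟩ := chain_common hc ht ht
        rcases key ψ hψ with e | e
        · exact e.2.2 h'
        · exact hr2.2 (e.1 h')
  · intro j a b hab hdom
    obtain ⟨φ, hφ, h1, h2⟩ := chain_common hc (hdom a (left_mem_Icc.2 hab))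
      (hdom b (right_mem_Icc.2 hab))
    have hI : ∀ t ∈ Icc a b, (t, j) ∈ φ.dom := fun t ht =>
      (φ.ordConnected_slice j).out h1 h2 ht
    refine (φ.locallyAC j a b hab hI).congr_uIcc fun t ht => ?_
    rw [uIcc_of_le hab] at ht
    exact hv φ hφ t j (hI t ht)

end HybridArc

/-! ### Existence of maximal solutions -/

theorem exists_rat_Icc_subset_of_mem_interior {S : Set ℝ} {t : ℝ} (h : t ∈ interior S) :
    ∃ p q : ℚ, t ∈ Ioo (p : ℝ) q ∧ Icc (p : ℝ) q ⊆ S := by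
  obtain ⟨a, b, ht, hsub⟩ := mem_nhds_iff_exists_Ioo_subset.1 (mem_interior_iff_mem_nhds.1 h)
  obtain ⟨p, hp⟩ := exists_rat_btwn ht.1
  obtain ⟨q, hq⟩ := exists_rat_btwn ht.2
  exact ⟨p, q, ⟨hp.2, hq.1⟩, fun x hx => hsub ⟨hp.1.trans_le hx.1, hx.2.trans_lt hq.2⟩⟩

namespace HybridSystem

variable {n : ℕ} {H : HybridSystem n}

/-- A compact piece of flow has both ends, hence all of its points, in a single member of the chain,
and the flow conditions are local. -/
theorem isSolution_of_chain {c : Set (HybridArc n)} (hc : IsChain HybridArc.Extends c)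
    (hne : c.Nonempty) (hsol : ∀ φ ∈ c, H.IsSolution φ) {ω : HybridArc n}
    (hdom : ω.dom = ⋃ φ ∈ c, φ.dom) (hext : ∀ φ ∈ c, φ.Extends ω) : H.IsSolution ω := by
  have hmem : ∀ j (p q : ℝ), p ≤ q → Icc p q ⊆ ω.slice j → ∃ φ ∈ c, Icc p q ⊆ φ.slice j := by
    intro j p q hpq h
    have h1 : (p, j) ∈ ω.dom := h (left_mem_Icc.2 hpq)
    have h2 : (q, j) ∈ ω.dom := h (right_mem_Icc.2 hpq)
    rw [hdom] at h1 h2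
    obtain ⟨φ, hφ, m1, m2⟩ := HybridArc.chain_common hc h1 h2
    exact ⟨φ, hφ, (φ.ordConnected_slice j).out m1 m2⟩
  refine ⟨?_, fun j t ht => ?_, fun j => ?_, fun t j h1 h2 => ?_⟩
  · obtain ⟨φ, hφ⟩ := hne
    rw [(hext φ hφ).val_zero]
    exact (hsol φ hφ).init
  · obtain ⟨p, q, hpq, hI⟩ := exists_rat_Icc_subset_of_mem_interior ht
    obtain ⟨φ, hφ, hI'⟩ := hmem j p q (hpq.1.trans hpq.2).le hI
    have htφ : t ∈ interior (φ.slice j) :=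
      mem_interior_iff_mem_nhds.2 (mem_of_superset (Icc_mem_nhds hpq.1 hpq.2) hI')
    rw [← (hext φ hφ).2 t j (interior_subset htφ : t ∈ φ.slice j)]
    exact (hsol φ hφ).flow_mem j t htφ
  -- The chain may be uncountable; rational intervals reduce the exceptional times to countably many
  -- null sets.
  · have hall : ∀ p q : ℚ, ∀ᵐ t : ℝ, t ∈ Ioo (p : ℝ) q → Icc (p : ℝ) q ⊆ ω.slice j →
        ∃ v ∈ H.F (ω.val t j), HasDerivAt (fun s => ω.val s j) v t := by
      intro p q
      by_cases hpq : (p : ℝ) ≤ q ∧ Icc (p : ℝ) q ⊆ ω.slice j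
      · obtain ⟨φ, hφ, hI'⟩ := hmem j p q hpq.1 hpq.2
        filter_upwards [(hsol φ hφ).flow_deriv j] with t ht htm _
        have hnhds : φ.slice j ∈ 𝓝 t := mem_of_superset (Icc_mem_nhds htm.1 htm.2) hI'
        obtain ⟨v, hv, hd⟩ := ht (mem_interior_iff_mem_nhds.2 hnhds)
        refine ⟨v, (hext φ hφ).2 t j (mem_of_mem_nhds hnhds : t ∈ φ.slice j) ▸ hv, hd.congr_of_eventuallyEq ?_⟩
        filter_upwards [hnhds] with s hs
        exact ((hext φ hφ).2 s j hs).symm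
      · exact Eventually.of_forall fun t ht hI => (hpq ⟨(ht.1.trans ht.2).le, hI⟩).elim
    filter_upwards [ae_all_iff.2 fun p => ae_all_iff.2 (hall p)] with t ht hti
    obtain ⟨p, q, hpq, hI⟩ := exists_rat_Icc_subset_of_mem_interior hti
    exact ht p q hpq hI
  · rw [hdom] at h1 h2
    obtain ⟨φ, hφ, m1, m2⟩ := HybridArc.chain_common hc h1 h2
    rw [← (hext φ hφ).2 _ _ m1, ← (hext φ hφ).2 _ _ m2]
    exact (hsol φ hφ).jump t j m1 m2

/-- Every solution extends to a maximal one. -/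
theorem IsSolution.exists_maximal {φ : HybridArc n} (hφ : H.IsSolution φ) :
    ∃ ψ, H.IsMaximalSolution ψ ∧ φ.Extends ψ := by
  let α := {ψ : HybridArc n // H.IsSolution ψ ∧ φ.Extends ψ}
  obtain ⟨m, hm⟩ := exists_maximal_of_chains_bounded
    (r := fun a b : α => a.1.Extends b.1) (fun c hc => by
      rcases c.eq_empty_or_nonempty with rfl | hne
      · exact ⟨⟨φ, hφ, .refl φ⟩, by simp⟩
      have hc' : IsChain HybridArc.Extends (Subtype.val '' c) := by
        rintro _ ⟨a, ha, rfl⟩ _ ⟨b, hb, rfl⟩ hab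
        exact hc ha hb fun h => hab (h ▸ rfl)
      obtain ⟨ω, hdom, hext⟩ := HybridArc.exists_chain_union hc' (hne.image _)
      have hω := isSolution_of_chain hc' (hne.image _)
        (by rintro _ ⟨a, -, rfl⟩; exact a.2.1) hdom hext
      obtain ⟨a, ha⟩ := hne
      exact ⟨⟨ω, hω, a.2.2.trans (hext _ ⟨a, ha, rfl⟩)⟩, fun b hb => hext _ ⟨b, hb, rfl⟩⟩)
    (fun h h' => HybridArc.Extends.trans h h')
  refine ⟨m.1, ⟨m.2.1, ?_⟩, m.2.2⟩
  rintro ⟨ψ, hψ, hss, hval⟩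
  have hmψ : m.1.Extends ψ := ⟨hss.1, hval⟩
  -- `Extends` is only a preorder, because values off the domain are free. Maximality therefore
  -- returns an extension in the opposite direction, which the strict inclusion of domains forbids.
  exact hss.2 (hm ⟨ψ, hψ, m.2.2.trans hmψ⟩ hmψ).1

end HybridSystem

/-! ### Concatenation of solutions -/

namespace HybridArc

variable {n : ℕ}

/-- `ω` follows `φ` up to the hybrid time `(t₀, j₀)`, and then `χ`. -/
structure IsConcat (φ χ : HybridArc n) (t₀ : ℝ) (j₀ : ℕ) (ω : HybridArc n) : Prop where
  mem_lt : ∀ t j, j < j₀ → ((t, j) ∈ ω.dom ↔ (t, j) ∈ φ.dom)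
  mem_left : ∀ t ≤ t₀, ((t, j₀) ∈ ω.dom ↔ (t, j₀) ∈ φ.dom)
  mem_right : ∀ t, t₀ ≤ t → ((t, j₀) ∈ ω.dom ↔ (t - t₀, 0) ∈ χ.dom)
  mem_gt : ∀ t k, ((t, j₀ + k + 1) ∈ ω.dom ↔ (t - t₀, k + 1) ∈ χ.dom)
  val_lt : ∀ t j, j < j₀ → ω.val t j = φ.val t j
  val_left : ∀ t ≤ t₀, ω.val t j₀ = φ.val t j₀
  val_right : ∀ t, t₀ ≤ t → ω.val t j₀ = χ.val (t - t₀) 0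
  val_gt : ∀ t k, ω.val t (j₀ + k + 1) = χ.val (t - t₀) (k + 1)

theorem exists_concat {φ χ : HybridArc n} {t₀ : ℝ} {j₀ : ℕ} (hmem : (t₀, j₀) ∈ φ.dom)
    (hval : χ.val 0 0 = φ.val t₀ j₀) : ∃ ω, IsConcat φ χ t₀ j₀ ω := by
  classical
  let E : Set (ℝ × ℕ) := {p | p ∈ φ.dom ∧ (p.2 < j₀ ∨ p.2 = j₀ ∧ p.1 ≤ t₀) ∨
    j₀ ≤ p.2 ∧ (p.1 - t₀, p.2 - j₀) ∈ χ.dom}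
  let v : ℝ → ℕ → State n := fun t j =>
    if j < j₀ ∨ j = j₀ ∧ t ≤ t₀ then φ.val t j else χ.val (t - t₀) (j - j₀)
  have χ0 := χ.isLeast_slice_zero
  have m1 : ∀ t j, j < j₀ → ((t, j) ∈ E ↔ (t, j) ∈ φ.dom) := by
    intro t j h
    simp [E, h, h.not_ge]
  have m2 : ∀ t ≤ t₀, ((t, j₀) ∈ E ↔ (t, j₀) ∈ φ.dom) := by
    intro t h
    simp only [E, mem_ofPred_eq, lt_self_iff_false, h, and_self, or_true, and_true, le_refl,
      Nat.sub_self, true_and, or_iff_left_iff_imp]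
    intro h'
    have : t = t₀ := le_antisymm h (by linarith [χ0.2 h'])
    rwa [this]
  have m3 : ∀ t, t₀ ≤ t → ((t, j₀) ∈ E ↔ (t - t₀, 0) ∈ χ.dom) := by
    intro t h
    simp only [E, mem_ofPred_eq, lt_self_iff_false, true_and, le_refl, false_or,
      Nat.sub_self, or_iff_right_iff_imp]
    rintro ⟨-, h'⟩
    rw [le_antisymm h' h, sub_self]
    exact χ0.1
  have m4 : ∀ t k, ((t, j₀ + k + 1) ∈ E ↔ (t - t₀, k + 1) ∈ χ.dom) := by
    intro t k
    have e1 : ¬ j₀ + k + 1 < j₀ := by omega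
    have e2 : ¬ j₀ + k + 1 = j₀ := by omega
    have e3 : j₀ ≤ j₀ + k + 1 := by omega
    have e4 : j₀ + k + 1 - j₀ = k + 1 := by omega
    simp [E, e1, e2, e3, e4]
  have v1 : ∀ t j, j < j₀ → v t j = φ.val t j := fun t j h => by simp [v, h]
  have v2 : ∀ t ≤ t₀, v t j₀ = φ.val t j₀ := fun t h => by simp [v, h]
  have v3 : ∀ t, t₀ ≤ t → v t j₀ = χ.val (t - t₀) 0 := by
    intro t h
    rcases h.eq_or_lt with rfl | h
    · simp [v, hval]
    · simp [v, h.not_ge]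
  have v4 : ∀ t k, v t (j₀ + k + 1) = χ.val (t - t₀) (k + 1) := by
    intro t k
    have e1 : ¬ j₀ + k + 1 < j₀ := by omega
    have e2 : ¬ j₀ + k + 1 = j₀ := by omega
    have e4 : j₀ + k + 1 - j₀ = k + 1 := by omega
    simp [v, e1, e2, e4]
  have cases : ∀ j, j < j₀ ∨ j = j₀ ∨ ∃ k, j = j₀ + k + 1 := by
    intro j
    rcases lt_trichotomy j j₀ with h | h | h
    · exact Or.inl h
    · exact Or.inr (Or.inl h)
    · exact Or.inr (Or.inr ⟨j - j₀ - 1, by omega⟩)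
  have s1 : ∀ j < j₀, {t | (t, j) ∈ E} = φ.slice j := fun j h => by
    ext t
    exact m1 t j h
  refine ⟨⟨E, v, isHybridTimeDomain_iff.2 ⟨?_, fun j => ?_, fun j s hs => ?_⟩, ?_⟩,
    m1, m2, m3, m4, v1, v2, v3, v4⟩
  · rcases Nat.eq_zero_or_pos j₀ with rfl | h
    · have ht₀ : 0 ≤ t₀ := φ.isLeast_slice_zero.2 hmem
      refine ⟨(m2 0 ht₀).2 φ.zero_mem_dom, fun t ht => ?_⟩
      rcases le_total t t₀ with h | h
      · exact φ.isLeast_slice_zero.2 ((m2 t h).1 ht)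
      · exact ht₀.trans h
    · rw [s1 0 h]
      exact φ.isLeast_slice_zero
  · rcases cases j with h | rfl | ⟨k, rfl⟩
    · rw [s1 j h]
      exact φ.ordConnected_slice j
    · refine ⟨fun a ha b hb t ht => ?_⟩
      rcases le_total t t₀ with h | h
      · exact (m2 t h).2 ((φ.ordConnected_slice j).out ((m2 a (ht.1.trans h)).1 ha) hmem
          ⟨ht.1, h⟩)
      · exact (m3 t h).2 ((χ.ordConnected_slice 0).out χ0.1 ((m3 b (h.trans ht.2)).1 hb)
          ⟨sub_nonneg.2 h, sub_le_sub_right ht.2 _⟩)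
    · refine ⟨fun a ha b hb t ht => ?_⟩
      exact (m4 t k).2 ((χ.ordConnected_slice (k + 1)).out ((m4 a k).1 ha) ((m4 b k).1 hb)
        ⟨sub_le_sub_right ht.1 _, sub_le_sub_right ht.2 _⟩)
  · rcases cases j with h | rfl | ⟨k, rfl⟩
    · rw [s1 j h]
      rcases (Nat.succ_le_of_lt h).lt_or_eq with h' | rfl
      · rw [s1 (j + 1) h']
        exact φ.exists_jump_time ((m1 s _ h').1 hs)
      · obtain ⟨r, hr1, hr2⟩ := φ.exists_jump_time hmem
        have hrt : r ≤ t₀ := hr2.2 hmem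
        refine ⟨r, hr1, (m2 r hrt).2 hr2.1, fun t ht => ?_⟩
        rcases le_total t t₀ with h | h
        · exact hr2.2 ((m2 t h).1 ht)
        · exact hrt.trans h
    · obtain ⟨r, hr1, hr2⟩ := χ.exists_jump_time ((m4 s 0).1 hs)
      have hr0 : 0 ≤ r := χ0.2 hr1.1
      refine ⟨t₀ + r, ⟨(m3 _ (by linarith)).2 ?_, fun t ht => ?_⟩, (m4 _ 0).2 ?_, fun t ht => ?_⟩
      · simpa [slice] using hr1.1
      · rcases le_total t t₀ with h | h
        · linarith
        · linarith [hr1.2 ((m3 t h).1 ht)]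
      · simpa [slice] using hr2.1
      · linarith [hr2.2 ((m4 t 0).1 ht)]
    · obtain ⟨r, hr1, hr2⟩ := χ.exists_jump_time ((m4 s (k + 1)).1 hs)
      refine ⟨t₀ + r, ⟨(m4 _ _).2 ?_, fun t ht => ?_⟩, (m4 _ (k + 1)).2 ?_, fun t ht => ?_⟩
      · simpa [slice] using hr1.1
      · linarith [hr1.2 ((m4 t k).1 ht)]
      · simpa [slice] using hr2.1
      · linarith [hr2.2 ((m4 t (k + 1)).1 ht)]
  · intro j a b hab hI
    have shift : ∀ k (a b : ℝ), a ≤ b → (∀ t ∈ Icc a b, (t - t₀, k) ∈ χ.dom) →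
        AbsolutelyContinuousOnInterval (fun t => χ.val (t - t₀) k) a b := by
      intro k a b hab hI
      refine AbsolutelyContinuousOnInterval.comp_sub_const
        (f := fun t => χ.val t k) (χ.locallyAC k _ _ (sub_le_sub_right hab _) fun t ht => ?_)
      simpa using hI (t + t₀) ⟨by linarith [ht.1], by linarith [ht.2]⟩
    rcases cases j with h | rfl | ⟨k, rfl⟩
    · simp only [v1 _ j h]
      exact φ.locallyAC j a b hab fun t ht => (m1 t j h).1 (hI t ht)
    · have left : ∀ c, a ≤ c → c ≤ b → c ≤ t₀ →
          AbsolutelyContinuousOnInterval (fun t => v t j) a c := by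
        intro c hac hcb hc
        refine (φ.locallyAC j a c hac fun t ht => (m2 t (ht.2.trans hc)).1
          (hI t ⟨ht.1, ht.2.trans hcb⟩)).congr_uIcc fun t ht => ?_
        rw [uIcc_of_le hac] at ht
        exact (v2 t (ht.2.trans hc)).symm
      have right : ∀ c, a ≤ c → c ≤ b → t₀ ≤ c →
          AbsolutelyContinuousOnInterval (fun t => v t j) c b := by
        intro c hac hcb hc
        refine (shift 0 c b hcb fun t ht => (m3 t (hc.trans ht.1)).1
          (hI t ⟨hac.trans ht.1, ht.2⟩)).congr_uIcc fun t ht => ?_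
        rw [uIcc_of_le hcb] at ht
        exact (v3 t (hc.trans ht.1)).symm
      -- An interval straddling the seam is cut at `t₀` and the two halves are glued.
      rcases le_total b t₀ with hb | hb
      · exact left b hab le_rfl hb
      rcases le_total t₀ a with ha | ha
      · exact right a le_rfl hab ha
      exact (left t₀ ha hb le_rfl).trans ha hb (right t₀ ha hb le_rfl)
    · simp only [v4]
      exact shift (k + 1) a b hab fun t ht => (m4 t k).1 (hI t ht)

end HybridArc

namespace HybridSystem

variable {n : ℕ} {H : HybridSystem n}

/-- At the right end of a nondegenerate interval of flow, a solution is in the closed set `C`. -/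
theorem IsSolution.mem_C_of_Icc_subset {φ : HybridArc n} (hφ : H.IsSolution φ)
    (hC : IsClosed H.C) {j : ℕ} {a b : ℝ} (hab : a < b) (hI : Icc a b ⊆ φ.slice j) :
    φ.val b j ∈ H.C := by
  have hcont := (φ.locallyAC j a b hab.le fun t ht => hI ht).continuousOn
  rw [uIcc_of_le hab.le] at hcont
  have ht : Tendsto (fun t => φ.val t j) (𝓝[Ioo a b] b) (𝓝 (φ.val b j)) :=
    (hcont b (right_mem_Icc.2 hab.le)).mono_left (nhdsWithin_mono b Ioo_subset_Icc_self)
  have : (𝓝[Ioo a b] b).NeBot := right_nhdsWithin_Ioo_neBot hab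
  refine hC.mem_of_tendsto ht (eventually_mem_nhdsWithin.mono fun t ht => ?_)
  exact hφ.flow_mem j t (mem_interior_iff_mem_nhds.2
    (mem_of_superset (Icc_mem_nhds ht.1 ht.2) hI))

/-- Away from the seam the arc is locally `φ` or a translate of `χ`. The seam is a null set for the
derivative condition. Closedness of `C` handles membership there, as `t₀` may be an end of the slice
of `φ`. -/
theorem IsSolution.concat (hC : IsClosed H.C) {φ χ ω : HybridArc n} (hφ : H.IsSolution φ)
    (hχ : H.IsSolution χ) {t₀ : ℝ} {j₀ : ℕ} (hmem : (t₀, j₀) ∈ φ.dom)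
    (hω : HybridArc.IsConcat φ χ t₀ j₀ ω) : ω.val 0 0 = φ.val 0 0 ∧ H.IsSolution ω := by
  have h0 : ω.val 0 0 = φ.val 0 0 := by
    rcases Nat.eq_zero_or_pos j₀ with rfl | h
    · exact hω.val_left 0 (φ.isLeast_slice_zero.2 hmem)
    · exact hω.val_lt 0 0 h
  have cases : ∀ j, j < j₀ ∨ j = j₀ ∨ ∃ k, j = j₀ + k + 1 := by
    intro j
    rcases lt_trichotomy j j₀ with h | h | h
    · exact Or.inl h
    · exact Or.inr (Or.inl h)
    · exact Or.inr (Or.inr ⟨j - j₀ - 1, by omega⟩)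
  -- Around an interior time other than `t₀`, the arc `ω` is locally `φ` or a shift of `χ`.
  have loc : ∀ j, ∀ t ∈ interior (ω.slice j), (j = j₀ → t ≠ t₀) →
      (t ∈ interior (φ.slice j) ∧ (fun s => ω.val s j) =ᶠ[𝓝 t] fun s => φ.val s j) ∨
      ∃ k, t - t₀ ∈ interior (χ.slice k) ∧
        (fun s => ω.val s j) =ᶠ[𝓝 t] fun s => χ.val (s - t₀) k := by
    intro j t ht hne
    rw [mem_interior_iff_mem_nhds] at ht
    have shift : ∀ k, (∀ᶠ s in 𝓝 t, (s - t₀, k) ∈ χ.dom) → t - t₀ ∈ interior (χ.slice k) := by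
      intro k hk
      rw [mem_interior_iff_mem_nhds]
      have hc : Tendsto (fun s : ℝ => s + t₀) (𝓝 (t - t₀)) (𝓝 t) := by
        simpa using (continuous_add_const t₀).tendsto (t - t₀)
      filter_upwards [hc.eventually hk] with s hs
      simpa [HybridArc.slice] using hs
    rcases cases j with h | rfl | ⟨k, rfl⟩
    · refine Or.inl ⟨mem_interior_iff_mem_nhds.2 ?_, .of_forall fun s => hω.val_lt s j h⟩
      filter_upwards [ht] with s hs
      exact (hω.mem_lt s j h).1 hs
    · rcases (hne rfl).lt_or_gt with h | h
      · refine Or.inl ⟨mem_interior_iff_mem_nhds.2 ?_, ?_⟩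
        · filter_upwards [ht, Iio_mem_nhds h] with s hs hs'
          exact (hω.mem_left s (le_of_lt hs')).1 hs
        · filter_upwards [Iio_mem_nhds h] with s hs
          exact hω.val_left s (le_of_lt hs)
      · refine Or.inr ⟨0, shift 0 ?_, ?_⟩
        · filter_upwards [ht, Ioi_mem_nhds h] with s hs hs'
          exact (hω.mem_right s (le_of_lt hs')).1 hs
        · filter_upwards [Ioi_mem_nhds h] with s hs
          exact hω.val_right s (le_of_lt hs)
    · refine Or.inr ⟨k + 1, shift _ ?_, .of_forall fun s => hω.val_gt s k⟩
      filter_upwards [ht] with s hs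
      exact (hω.mem_gt s k).1 hs
  refine ⟨h0, ⟨h0 ▸ hφ.init, fun j t ht => ?_, fun j => ?_, fun t j h1 h2 => ?_⟩⟩
  · by_cases hj : j = j₀ ∧ t = t₀
    · obtain ⟨rfl, rfl⟩ := hj
      obtain ⟨p, q, hpq, hI⟩ := exists_rat_Icc_subset_of_mem_interior ht
      rw [hω.val_left t le_rfl]
      refine hφ.mem_C_of_Icc_subset hC hpq.1 fun s hs => ?_
      exact (hω.mem_left s hs.2).1 (hI ⟨hs.1, hs.2.trans hpq.2.le⟩)
    · rcases loc j t ht fun h h' => hj ⟨h, h'⟩ with ⟨h, e⟩ | ⟨k, h, e⟩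
      · rw [show ω.val t j = φ.val t j from e.eq_of_nhds]
        exact hφ.flow_mem j t h
      · rw [show ω.val t j = χ.val (t - t₀) k from e.eq_of_nhds]
        exact hχ.flow_mem k _ h
  · have hχd : ∀ k, ∀ᵐ t : ℝ, t - t₀ ∈ interior (χ.slice k) →
        ∃ v ∈ H.F (χ.val (t - t₀) k), HasDerivAt (fun s => χ.val s k) v (t - t₀) := fun k =>
      (measurePreserving_sub_right volume t₀).quasiMeasurePreserving.ae (hχ.flow_deriv k)
    have hne : ∀ᵐ t : ℝ, t ≠ t₀ := by simp [ae_iff]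
    filter_upwards [hφ.flow_deriv j, ae_all_iff.2 hχd, hne] with t h1 h2 h3 ht
    rcases loc j t ht fun _ => h3 with ⟨h, e⟩ | ⟨k, h, e⟩
    · rw [show ω.val t j = φ.val t j from e.eq_of_nhds]
      obtain ⟨v, hv, hd⟩ := h1 h
      exact ⟨v, hv, hd.congr_of_eventuallyEq e⟩
    · rw [show ω.val t j = χ.val (t - t₀) k from e.eq_of_nhds]
      obtain ⟨v, hv, hd⟩ := h2 k h
      exact ⟨v, hv, (hd.comp_sub_const t t₀).congr_of_eventuallyEq e⟩
  · rcases cases j with h | rfl | ⟨k, rfl⟩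
    · rw [hω.mem_lt t j h] at h1
      rw [hω.val_lt t j h]
      rcases (Nat.succ_le_of_lt h).lt_or_eq with h' | rfl
      · rw [hω.val_lt t _ h']
        exact hφ.jump t j h1 ((hω.mem_lt t _ h').1 h2)
      · obtain ⟨r, hr1, hr2⟩ := φ.exists_jump_time hmem
        have ht : t ≤ t₀ := (hr1.2 h1).trans (hr2.2 hmem)
        have e : ω.val t (j + 1) = φ.val t (j + 1) := hω.val_left t ht
        rw [e]
        exact hφ.jump t j h1 ((hω.mem_left t ht).1 h2)
    · have h2' := (hω.mem_gt t 0).1 h2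
      obtain ⟨r, hr1, hr2⟩ := χ.exists_jump_time h2'
      have ht : t₀ ≤ t := sub_nonneg.1 ((χ.isLeast_slice_zero.2 hr1.1).trans (hr2.2 h2'))
      rw [hω.val_right t ht, show ω.val t (j + 1) = _ from hω.val_gt t 0]
      exact hχ.jump _ 0 ((hω.mem_right t ht).1 h1) h2'
    · rw [hω.val_gt t k, show ω.val t (j₀ + k + 1 + 1) = _ from hω.val_gt t (k + 1)]
      exact hχ.jump _ _ ((hω.mem_gt t k).1 h1) ((hω.mem_gt t (k + 1)).1 h2)

/-- A solution that starts where another one passes is the tail of a solution. -/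
theorem IsSolution.exists_concat (hC : IsClosed H.C) {φ χ : HybridArc n} (hφ : H.IsSolution φ)
    (hχ : H.IsSolution χ) {t₀ : ℝ} {j₀ : ℕ} (hmem : (t₀, j₀) ∈ φ.dom)
    (hval : χ.val 0 0 = φ.val t₀ j₀) :
    ∃ ω, H.IsSolution ω ∧ ω.val 0 0 = φ.val 0 0 ∧ ∀ s k, (s, k) ∈ χ.dom →
      (t₀ + s, j₀ + k) ∈ ω.dom ∧ ω.val (t₀ + s) (j₀ + k) = χ.val s k := by
  obtain ⟨ω, hω⟩ := HybridArc.exists_concat hmem hval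
  obtain ⟨h0, hsol⟩ := hφ.concat hC hχ hmem hω
  refine ⟨ω, hsol, h0, fun s k hs => ?_⟩
  cases k with
  | zero =>
    have h : t₀ ≤ t₀ + s := le_add_of_nonneg_right (χ.isLeast_slice_zero.2 hs)
    refine ⟨(hω.mem_right _ h).2 (by simpa using hs), ?_⟩
    simpa using hω.val_right _ h
  | succ k =>
    refine ⟨(hω.mem_gt _ k).2 (by simpa using hs), ?_⟩
    simpa [← Nat.add_assoc] using hω.val_gt (t₀ + s) k

end HybridSystem

/-! ### Enlargement by balls and uniform Lipschitz constants -/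

theorem mem_add_closedBall_of_norm_sub_le {n : ℕ} {S : Set (State n)} {w z : State n} {a b : ℝ}
    (hw : w ∈ S + Metric.closedBall 0 a) (h : ‖z - w‖ ≤ b - a) :
    z ∈ S + Metric.closedBall 0 b := by
  obtain ⟨s, hs, u, hu, rfl⟩ := Set.mem_add.1 hw
  rw [mem_closedBall_zero_iff] at hu
  refine Set.mem_add.2 ⟨s, hs, u + (z - (s + u)), ?_, by abel⟩
  rw [mem_closedBall_zero_iff]
  linarith [norm_add_le u (z - (s + u))]

theorem add_closedBall_subset {n : ℕ} (S : Set (State n)) {a b : ℝ} (h : a ≤ b) :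
    S + Metric.closedBall 0 a ⊆ S + Metric.closedBall 0 b :=
  add_subset_add_left (Metric.closedBall_subset_closedBall h)

/-- A locally Lipschitz set-valued map is uniformly Lipschitz near a compact set. -/
theorem SetValuedLocallyLipschitzOn.exists_uniform {n : ℕ} {M : State n → Set (State n)}
    {O K : Set (State n)} (h : SetValuedLocallyLipschitzOn M O) (hK : IsCompact K) (hKO : K ⊆ O) :
    ∃ r > 0, ∃ L > 0, ∀ z ∈ K, ∀ w, ‖w - z‖ ≤ r →
      M w ⊆ M z + Metric.closedBall 0 (L * ‖w - z‖) := by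
  refine hK.induction_on
    (p := fun S => ∃ r > 0, ∃ L > 0, ∀ z ∈ S, ∀ w, ‖w - z‖ ≤ r →
      M w ⊆ M z + Metric.closedBall 0 (L * ‖w - z‖)) ?_ ?_ ?_ ?_
  · exact ⟨1, one_pos, 1, one_pos, by simp⟩
  · rintro S S' hS ⟨r, hr, L, hL, H⟩
    exact ⟨r, hr, L, hL, fun z hz => H z (hS hz)⟩
  · rintro S S' ⟨r, hr, L, hL, H⟩ ⟨r', hr', L', hL', H'⟩
    refine ⟨min r r', lt_min hr hr', max L L', lt_max_of_lt_left hL, fun z hz w hw => ?_⟩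
    rcases hz with hz | hz
    · exact (H z hz w (hw.trans (min_le_left _ _))).trans (add_closedBall_subset _
        (mul_le_mul_of_nonneg_right (le_max_left _ _) (norm_nonneg _)))
    · exact (H' z hz w (hw.trans (min_le_right _ _))).trans (add_closedBall_subset _
        (mul_le_mul_of_nonneg_right (le_max_right _ _) (norm_nonneg _)))
  · intro x hx
    obtain ⟨N, hN, -, L, hL, HL⟩ := h x (hKO hx)
    obtain ⟨ρ, hρ, hball⟩ := Metric.mem_nhds_iff.1 hN
    -- Half the radius for `z` and half for the displacement keep both points in `N`.
    refine ⟨Metric.ball x (ρ / 2), mem_nhdsWithin_of_mem_nhds (Metric.ball_mem_nhds x (half_pos hρ)),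
      ρ / 2, half_pos hρ, L, hL, fun z hz w hw => ?_⟩
    rw [← dist_eq_norm] at hw
    rw [Metric.mem_ball] at hz
    have h1 : z ∈ N := hball (by rw [Metric.mem_ball]; linarith)
    have h2 : w ∈ N := hball (by rw [Metric.mem_ball]; linarith [dist_triangle w z x])
    rw [norm_sub_rev]
    exact HL w h2 z h1

/-! ### Boundedness of arcs up to a given hybrid time -/

namespace HybridArc

variable {n : ℕ}

theorem le_of_lt_jumps (φ : HybridArc n) {t t' : ℝ} {j j' : ℕ} (h : (t, j) ∈ φ.dom)
    (h' : (t', j') ∈ φ.dom) (hj : j < j') : t ≤ t' := by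
  induction j', hj using Nat.le_induction generalizing t' with
  | base =>
    obtain ⟨r, h1, h2⟩ := φ.exists_jump_time h'
    exact (h1.2 h).trans (h2.2 h')
  | succ k _ ih =>
    obtain ⟨r, h1, h2⟩ := φ.exists_jump_time h'
    exact (ih h1.1).trans (h2.2 h')

theorem nonneg_of_mem_dom (φ : HybridArc n) {t : ℝ} {j : ℕ} (h : (t, j) ∈ φ.dom) : 0 ≤ t := by
  rcases Nat.eq_zero_or_pos j with rfl | hj
  · exact φ.isLeast_slice_zero.2 h
  · exact φ.le_of_lt_jumps φ.zero_mem_dom h hj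

theorem exists_mem_slice_of_le (φ : HybridArc n) {t : ℝ} {i j : ℕ} (h : (t, j) ∈ φ.dom)
    (hij : i ≤ j) : ∃ s, (s, i) ∈ φ.dom := by
  induction j, hij using Nat.le_induction generalizing t with
  | base => exact ⟨t, h⟩
  | succ k _ ih =>
    obtain ⟨r, h1, -⟩ := φ.exists_jump_time h
    exact ih h1.1

theorem exists_isLeast_slice (φ : HybridArc n) {t : ℝ} {j : ℕ} (h : (t, j) ∈ φ.dom) :
    ∃ a, IsLeast (φ.slice j) a := by
  cases j with
  | zero => exact ⟨0, φ.isLeast_slice_zero⟩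
  | succ j =>
    obtain ⟨r, -, h2⟩ := φ.exists_jump_time h
    exact ⟨r, h2⟩

/-- A hybrid arc is bounded before any hybrid time of its domain. -/
theorem isBounded_before (φ : HybridArc n) {t₀ : ℝ} {j₀ : ℕ} (h₀ : (t₀, j₀) ∈ φ.dom) :
    Bornology.IsBounded
      {x | ∃ t j, (t, j) ∈ φ.dom ∧ t + (j : ℝ) < t₀ + (j₀ : ℝ) ∧ φ.val t j = x} := by
  -- Up to `(t₀, j₀)` the domain consists of finitely many compact intervals, on which the arc is
  -- continuous.
  have hseg : ∀ j ≤ j₀, ∃ a b : ℝ, Icc a b ⊆ φ.slice j ∧ a ≤ b ∧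
      ∀ t ∈ φ.slice j, (j = j₀ → t ≤ t₀) → t ∈ Icc a b := by
    intro j hj
    obtain ⟨s, hs⟩ := φ.exists_mem_slice_of_le h₀ hj
    obtain ⟨a, ha⟩ := φ.exists_isLeast_slice hs
    rcases hj.lt_or_eq with h | rfl
    · obtain ⟨s', hs'⟩ := φ.exists_mem_slice_of_le h₀ (Nat.succ_le_of_lt h)
      obtain ⟨r, h1, -⟩ := φ.exists_jump_time hs'
      exact ⟨a, r, (φ.ordConnected_slice j).out ha.1 h1.1, ha.2 h1.1,
        fun t ht _ => ⟨ha.2 ht, h1.2 ht⟩⟩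
    · exact ⟨a, t₀, (φ.ordConnected_slice j).out ha.1 h₀, ha.2 h₀,
        fun t ht hle => ⟨ha.2 ht, hle rfl⟩⟩
  choose! a b hsub hab hmem using hseg
  have hbdd : Bornology.IsBounded (⋃ j ∈ Finset.range (j₀ + 1),
      (fun t => φ.val t j) '' Icc (a j) (b j)) := by
    refine (Bornology.isBounded_biUnion_finset _).2 fun j hj => ?_
    have hj' : j ≤ j₀ := Nat.lt_succ_iff.1 (Finset.mem_range.1 hj)
    have hcont := (φ.locallyAC j _ _ (hab j hj') fun t ht => hsub j hj' ht).continuousOn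
    rw [uIcc_of_le (hab j hj')] at hcont
    exact (isCompact_Icc.image_of_continuousOn hcont).isBounded
  refine hbdd.subset ?_
  rintro _ ⟨t, j, h, hlt, rfl⟩
  have hj : j ≤ j₀ := by
    by_contra! hj
    have h1 := φ.le_of_lt_jumps h₀ h hj
    have h2 : (j₀ : ℝ) ≤ j := by exact_mod_cast hj.le
    linarith
  simp only [mem_iUnion, Finset.mem_range]
  refine ⟨j, Nat.lt_succ_of_le hj, t, hmem j hj t h ?_, rfl⟩
  rintro rfl
  linarith

end HybridArc

/-! ### Monotonicity in the perturbation, and the staying set -/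

namespace HybridSystem

variable {n : ℕ} {H : HybridSystem n}

theorem IsSolution.perturb_mono {a b : ℝ} (hab : a ≤ b) {φ : HybridArc n}
    (hφ : (H.perturb a).IsSolution φ) : (H.perturb b).IsSolution φ := by
  refine ⟨?_, fun j t ht => add_closedBall_subset _ hab (hφ.flow_mem j t ht), fun j => ?_,
    fun t j h1 h2 => ?_⟩
  · exact union_subset_union (closure_mono (add_closedBall_subset _ hab))
      (add_closedBall_subset _ hab) hφ.init
  · filter_upwards [hφ.flow_deriv j] with t h ht
    obtain ⟨v, hv, hd⟩ := h ht
    exact ⟨v, add_closedBall_subset _ hab hv, hd⟩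
  · obtain ⟨h3, h4⟩ := hφ.jump t j h1 h2
    exact ⟨add_closedBall_subset _ hab h3, add_closedBall_subset _ hab h4⟩

theorem isClosed_perturb_C (hC : IsClosed H.C) (δ : ℝ) : IsClosed (H.perturb δ).C :=
  hC.add_right_of_isCompact (isCompact_closedBall 0 δ)

theorem isClosed_perturb_D (hD : IsClosed H.D) (δ : ℝ) : IsClosed (H.perturb δ).D :=
  hD.add_right_of_isCompact (isCompact_closedBall 0 δ)

/-- The points of `I` from which no solution ever leaves `I`. -/
def stayingSet (H : HybridSystem n) (I : Set (State n)) : Set (State n) :=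
  {x | x ∈ I ∧ ∀ φ : HybridArc n, H.IsSolution φ → φ.val 0 0 = x → φ.rge ⊆ I}

/-- Forward invariance: a solution leaving `I` from `φ(t, j)`, appended to `φ`, would leave `I` from
`φ(0, 0)`. -/
theorem IsSolution.mem_stayingSet (hC : IsClosed H.C) {I : Set (State n)} {φ : HybridArc n}
    (hφ : H.IsSolution φ) (h0 : φ.val 0 0 ∈ H.stayingSet I) {t : ℝ} {j : ℕ}
    (h : (t, j) ∈ φ.dom) : φ.val t j ∈ H.stayingSet I := by
  refine ⟨h0.2 φ hφ rfl ⟨t, j, h, rfl⟩, fun χ hχ hval => ?_⟩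
  rintro _ ⟨s, k, hs, rfl⟩
  obtain ⟨ω, hω, hω0, hωχ⟩ := hφ.exists_concat hC hχ h hval
  obtain ⟨hm, he⟩ := hωχ s k hs
  exact h0.2 ω hω hω0 ⟨_, _, hm, he⟩

end HybridSystem

/-! ### Steering a solution to a nearby starting point -/

/-- The weight that decreases from `1` to `0` along the first unit of flow before any jump. -/
noncomputable def steeringWeight (j : ℕ) (t : ℝ) : ℝ := if j = 0 then max 0 (1 - t) else 0

theorem steeringWeight_mem_Icc {t : ℝ} (ht : 0 ≤ t) (j : ℕ) : steeringWeight j t ∈ Icc 0 1 := by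
  unfold steeringWeight
  split_ifs
  · exact ⟨le_max_left _ _, max_le zero_le_one (by linarith)⟩
  · simp

theorem steeringWeight_eq_zero {t : ℝ} {j : ℕ} (h : 1 ≤ t + (j : ℝ)) :
    steeringWeight j t = 0 := by
  unfold steeringWeight
  split_ifs with hj
  · subst hj
    exact max_eq_left (by simpa using h)
  · rfl

theorem lipschitzWith_steeringWeight (j : ℕ) : LipschitzWith 1 (steeringWeight j) := by
  by_cases hj : j = 0
  · have : steeringWeight j = fun t => max (1 - t) 0 := by
      ext t
      simp [steeringWeight, hj, max_comm]
    rw [this]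
    exact (LipschitzWith.of_dist_le_mul fun x y => by
      rw [Real.dist_eq, Real.dist_eq, sub_sub_sub_cancel_left, abs_sub_comm]
      simp).max_const 0
  · have : steeringWeight j = fun _ => 0 := by
      ext t
      simp [steeringWeight, hj]
    rw [this]
    exact LipschitzWith.const' 0

theorem exists_hasDerivAt_steeringWeight (j : ℕ) {t : ℝ} (ht : t ≠ 1) :
    ∃ e : ℝ, |e| ≤ 1 ∧ HasDerivAt (steeringWeight j) e t := by
  by_cases hj : j = 0
  · rcases ht.lt_or_gt with h | h
    · refine ⟨-1, by simp, ((hasDerivAt_id t).const_sub 1).congr_of_eventuallyEq ?_⟩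
      filter_upwards [Iio_mem_nhds h] with s hs
      have hs' : s < 1 := hs
      simp [steeringWeight, hj, hs'.le]
    · refine ⟨0, by simp, (hasDerivAt_const t (0 : ℝ)).congr_of_eventuallyEq ?_⟩
      filter_upwards [Ioi_mem_nhds h] with s hs
      have hs' : 1 < s := hs
      simp [steeringWeight, hj, hs'.le]
  · refine ⟨0, by simp, (hasDerivAt_const t (0 : ℝ)).congr_of_eventuallyEq ?_⟩
    exact .of_forall fun s => by simp [steeringWeight, hj]

namespace HybridArc

variable {n : ℕ}

/-- The arc `φ` translated by `d` at the start, the translation being undone during the first unit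
of hybrid time. -/
noncomputable def steer (φ : HybridArc n) (d : State n) : HybridArc n where
  dom := φ.dom
  val t j := φ.val t j + steeringWeight j t • d
  isDomain := φ.isDomain
  locallyAC j a b hab h := by
    have hw : AbsolutelyContinuousOnInterval (steeringWeight j) a b :=
      (lipschitzWith_steeringWeight j).lipschitzOnWith.absolutelyContinuousOnInterval
    have hd : AbsolutelyContinuousOnInterval (fun _ : ℝ => d) a b :=
      (LipschitzWith.const d).lipschitzOnWith.absolutelyContinuousOnInterval
    exact (φ.locallyAC j a b hab h).add (hw.smul hd)

theorem steer_val_zero (φ : HybridArc n) (d : State n) :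
    (φ.steer d).val 0 0 = φ.val 0 0 + d := by
  simp [steer, steeringWeight]

theorem steer_val_eq (φ : HybridArc n) (d : State n) {t : ℝ} {j : ℕ}
    (h : 1 ≤ t + (j : ℝ)) : (φ.steer d).val t j = φ.val t j := by
  simp [steer, steeringWeight_eq_zero h]

theorem norm_steer_val_sub_le (φ : HybridArc n) (d : State n) {t : ℝ} (ht : 0 ≤ t) (j : ℕ) :
    ‖(φ.steer d).val t j - φ.val t j‖ ≤ ‖d‖ := by
  obtain ⟨h0, h1⟩ := steeringWeight_mem_Icc ht j
  have : (φ.steer d).val t j - φ.val t j = steeringWeight j t • d := by simp [steer]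
  rw [this, norm_smul, Real.norm_of_nonneg h0]
  exact mul_le_of_le_one_left (norm_nonneg d) h1

/-- The restriction of an arc to the initial interval `[0, s]` of flow. -/
def initialFlow (φ : HybridArc n) (s : ℝ) (hs : (s, 0) ∈ φ.dom) : HybridArc n where
  dom := {p | p.1 ∈ Icc 0 s ∧ p.2 = 0}
  val := φ.val
  isDomain := by
    have h0 : 0 ≤ s := φ.nonneg_of_mem_dom hs
    refine isHybridTimeDomain_iff.2 ⟨?_, fun j => ?_, fun j t h => absurd h.2 (Nat.succ_ne_zero j)⟩
    · simpa using! isLeast_Icc h0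
    · by_cases hj : j = 0
      · simpa [hj] using! (ordConnected_Icc : (Icc 0 s).OrdConnected)
      · simpa [hj] using! ordConnected_empty
  locallyAC j a b hab h := by
    refine φ.locallyAC j a b hab fun t ht => ?_
    obtain ⟨h1, h2⟩ := h t ht
    dsimp only at h1 h2
    subst h2
    exact (φ.ordConnected_slice 0).out φ.zero_mem_dom hs h1

theorem slice_initialFlow_subset (φ : HybridArc n) (s : ℝ) (hs : (s, 0) ∈ φ.dom) (j : ℕ) :
    (φ.initialFlow s hs).slice j ⊆ φ.slice j := by
  rintro t ⟨h1, h2⟩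
  dsimp only at h1 h2
  subst h2
  exact (φ.ordConnected_slice 0).out φ.zero_mem_dom hs h1

end HybridArc

namespace HybridSystem

variable {n : ℕ} {H : HybridSystem n}

/-- Truncation lets the steered arc be used as a solution up to a first exit time, before it is
known to be one on its whole domain. -/
theorem IsSolution.initialFlow {φ : HybridArc n} (hφ : H.IsSolution φ) {s : ℝ}
    (hs : (s, 0) ∈ φ.dom) : H.IsSolution (φ.initialFlow s hs) := by
  refine ⟨hφ.init, fun j t ht => ?_, fun j => ?_, fun t j _ h => absurd h.2 (Nat.succ_ne_zero j)⟩
  · exact hφ.flow_mem j t (interior_mono (φ.slice_initialFlow_subset s hs j) ht)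
  · filter_upwards [hφ.flow_deriv j] with t h ht
    exact h (interior_mono (φ.slice_initialFlow_subset s hs j) ht)

/-- The error budget: `δ'` from the given perturbation, `L * ‖d‖` for moving the base point from `w`
to `z`, and `‖d‖` for the extra velocity `u`. -/
theorem add_mem_perturbed_values {M : State n → Set (State n)} {w z v d : State n}
    {L δ δ' : ℝ} (hM : M w ⊆ M z + Metric.closedBall 0 (L * ‖d‖))
    (hv : v ∈ M w + Metric.closedBall 0 δ') {u : State n} (hu : ‖u‖ ≤ ‖d‖)
    (hd : (L + 1) * ‖d‖ ≤ δ - δ') : v + u ∈ M z + Metric.closedBall 0 δ := by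
  obtain ⟨f, hf, a, ha, rfl⟩ := Set.mem_add.1 hv
  obtain ⟨g, hg, b, hb, rfl⟩ := Set.mem_add.1 (hM hf)
  rw [mem_closedBall_zero_iff] at ha hb
  refine Set.mem_add.2 ⟨g, hg, b + a + u, ?_, by abel⟩
  rw [mem_closedBall_zero_iff]
  linarith [norm_add_le (b + a) u, norm_add_le b a]

/-- Steering a solution of `H_δ'` gives a solution of `H_δ` if the translation is small. -/
theorem IsSolution.steer {δ δ' L : ℝ} (hL : 0 ≤ L) (hC : IsClosed H.C) {φ : HybridArc n}
    (hφ : (H.perturb δ').IsSolution φ) {d : State n} (hd : (L + 1) * ‖d‖ ≤ δ - δ')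
    (hF : ∀ j, ∀ t ∈ interior (φ.slice j), (φ.steer d).val t j ∈ (H.perturb δ).C →
      H.F (φ.val t j) ⊆ H.F ((φ.steer d).val t j) + Metric.closedBall 0 (L * ‖d‖))
    (hG : ∀ t j, (t, j) ∈ φ.dom → (t, j + 1) ∈ φ.dom →
      (φ.steer d).val t j ∈ (H.perturb δ).D →
      H.G (φ.val t j) ⊆ H.G ((φ.steer d).val t j) + Metric.closedBall 0 (L * ‖d‖)) :
    (H.perturb δ).IsSolution (φ.steer d) := by
  have hd' : ‖d‖ ≤ δ - δ' := by nlinarith [norm_nonneg d]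
  have hsub : ∀ t j, 0 ≤ t → ‖(φ.steer d).val t j - φ.val t j‖ ≤ δ - δ' := fun t j ht =>
    (φ.norm_steer_val_sub_le d ht j).trans hd'
  have hnn : ∀ j, ∀ t ∈ interior (φ.slice j), 0 ≤ t := fun j t ht =>
    φ.nonneg_of_mem_dom (interior_subset ht : t ∈ φ.slice j)
  have hflow : ∀ j, ∀ t ∈ interior (φ.slice j), (φ.steer d).val t j ∈ (H.perturb δ).C :=
    fun j t ht => mem_add_closedBall_of_norm_sub_le (hφ.flow_mem j t ht) (hsub t j (hnn j t ht))
  refine ⟨?_, hflow, fun j => ?_, fun t j h1 h2 => ?_⟩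
  · have h := hφ.init
    rw [(isClosed_perturb_C hC δ').closure_eq] at h
    exact h.imp
      (fun h => subset_closure (mem_add_closedBall_of_norm_sub_le h (hsub 0 0 le_rfl)))
      (fun h => mem_add_closedBall_of_norm_sub_le h (hsub 0 0 le_rfl))
  -- The weight has a corner at time 1.
  · have hne : ∀ᵐ t : ℝ, t ≠ 1 := by simp [ae_iff]
    filter_upwards [hφ.flow_deriv j, hne] with t h h1 ht
    obtain ⟨v, hv, hdv⟩ := h ht
    obtain ⟨e, he, hde⟩ := exists_hasDerivAt_steeringWeight j h1
    refine ⟨v + e • d, add_mem_perturbed_values (hF j t ht (hflow j t ht)) hv ?_ hd,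
      hdv.add (hde.smul_const d)⟩
    rw [norm_smul]
    exact mul_le_of_le_one_left (norm_nonneg d) he
  · obtain ⟨h3, h4⟩ := hφ.jump t j h1 h2
    have ht : 0 ≤ t := φ.nonneg_of_mem_dom h1
    have hD : (φ.steer d).val t j ∈ (H.perturb δ).D :=
      mem_add_closedBall_of_norm_sub_le h3 (hsub t j ht)
    refine ⟨hD, ?_⟩
    have hj : 1 ≤ t + ((j + 1 : ℕ) : ℝ) := by
      push_cast
      linarith [(Nat.cast_nonneg j : (0 : ℝ) ≤ j)]
    -- The weight is 0 after a jump, so the jump target is unmoved and the correction is `u = 0`.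
    rw [φ.steer_val_eq d hj, ← add_zero (φ.val t (j + 1))]
    exact add_mem_perturbed_values (hG t j h1 h2 hD) h4 (by simp) hd

/-- Solutions of `H_δ'` that start near a point `x` of the staying set of `H_δ` can be steered
to be solutions of `H_δ` from `x`. -/
theorem exists_steering_radius {δ δ' : ℝ} (hδ : δ' < δ) (hC : IsClosed H.C) (hD : IsClosed H.D)
    (hF : ∃ O : Set (State n), IsOpen O ∧ (H.perturb δ).C ⊆ O ∧
      SetValuedLocallyLipschitzOn H.F O)
    (hG : ∃ O : Set (State n), IsOpen O ∧ (H.perturb δ).D ⊆ O ∧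
      SetValuedLocallyLipschitzOn H.G O)
    {I : Set (State n)} (hI : IsCompact I) :
    ∃ r > 0, ∀ φ, (H.perturb δ').IsSolution φ → ∀ x ∈ (H.perturb δ).stayingSet I,
      ‖x - φ.val 0 0‖ < r → (H.perturb δ).IsSolution (φ.steer (x - φ.val 0 0)) := by
  obtain ⟨OF, -, hOF, hLF⟩ := hF
  obtain ⟨OG, -, hOG, hLG⟩ := hG
  -- For `F` a neighbourhood of `I` is needed: until the exit argument below is complete, the
  -- steered arc is only known to be within distance 1 of `I`.
  obtain ⟨r₁, hr₁, L₁, hL₁, H₁⟩ := hLF.exists_uniform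
    ((hI.cthickening (r := 1)).inter_right (isClosed_perturb_C hC δ)) (inter_subset_right.trans hOF)
  obtain ⟨r₂, hr₂, L₂, hL₂, H₂⟩ := hLG.exists_uniform
    (hI.inter_right (isClosed_perturb_D hD δ)) (inter_subset_right.trans hOG)
  set L := max L₁ L₂
  have hL : 0 < L := lt_max_of_lt_left hL₁
  refine ⟨min (min r₁ r₂) ((δ - δ') / (L + 1)),
    lt_min (lt_min hr₁ hr₂) (div_pos (by linarith) (by linarith)), fun φ hφ x hx hlt => ?_⟩
  set d := x - φ.val 0 0 with hd
  have hdr₁ : ‖d‖ ≤ r₁ := hlt.le.trans ((min_le_left _ _).trans (min_le_left _ _))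
  have hdr₂ : ‖d‖ ≤ r₂ := hlt.le.trans ((min_le_left _ _).trans (min_le_right _ _))
  have hdL : (L + 1) * ‖d‖ ≤ δ - δ' := by
    have := hlt.le.trans (min_le_right _ _)
    rwa [le_div_iff₀' (by linarith)] at this
  have hψ0 : (φ.steer d).val 0 0 = x := by
    rw [φ.steer_val_zero, hd]
    abel
  have estF : ∀ t j, 0 ≤ t → (φ.steer d).val t j ∈ Metric.cthickening 1 I →
      (φ.steer d).val t j ∈ (H.perturb δ).C →
      H.F (φ.val t j) ⊆ H.F ((φ.steer d).val t j) + Metric.closedBall 0 (L * ‖d‖) := by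
    intro t j ht hm hm'
    have hn := φ.norm_steer_val_sub_le d ht j
    rw [norm_sub_rev] at hn
    refine (H₁ _ ⟨hm, hm'⟩ _ (hn.trans hdr₁)).trans (add_closedBall_subset _ ?_)
    exact mul_le_mul (le_max_left _ _) hn (norm_nonneg _) hL.le
  have estG : ∀ t j, 0 ≤ t → (φ.steer d).val t j ∈ I →
      (φ.steer d).val t j ∈ (H.perturb δ).D →
      H.G (φ.val t j) ⊆ H.G ((φ.steer d).val t j) + Metric.closedBall 0 (L * ‖d‖) := by
    intro t j ht hm hm'
    have hn := φ.norm_steer_val_sub_le d ht j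
    rw [norm_sub_rev] at hn
    refine (H₂ _ ⟨hm, hm'⟩ _ (hn.trans hdr₂)).trans (add_closedBall_subset _ ?_)
    exact mul_le_mul (le_max_right _ _) hn (norm_nonneg _) hL.le
  -- Exit argument: let `s` be the first time at which the distance to `I` reaches `min (g b) 1`.
  -- Before `s` the Lipschitz bound applies, so the arc truncated at `s` solves the `δ`-system from
  -- `x`. As `x` is in the staying set, the distance at `s` is 0, a contradiction.
  have hstay : ∀ t, (t, 0) ∈ φ.dom → (φ.steer d).val t 0 ∈ I := by
    intro b hb
    by_contra hbI
    have hne : I.Nonempty := ⟨x, hx.1⟩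
    have hb0 : 0 ≤ b := φ.nonneg_of_mem_dom hb
    have hsub : Icc 0 b ⊆ φ.slice 0 := (φ.ordConnected_slice 0).out φ.zero_mem_dom hb
    set g : ℝ → ℝ := fun t => Metric.infDist ((φ.steer d).val t 0) I
    have hcont := ((φ.steer d).locallyAC 0 0 b hb0 fun t ht => hsub ht).continuousOn
    rw [uIcc_of_le hb0] at hcont
    have hg : ContinuousOn g (Icc 0 b) := (Metric.continuous_infDist_pt I).comp_continuousOn hcont
    have hgb : 0 < g b := (hI.isClosed.notMem_iff_infDist_pos hne).1 hbI
    have hZ : IsCompact (Icc 0 b ∩ g ⁻¹' Ici (min (g b) 1)) :=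
      isCompact_Icc.of_isClosed_subset (hg.preimage_isClosed_of_isClosed isClosed_Icc isClosed_Ici)
        inter_subset_left
    obtain ⟨s, ⟨hs, hgs⟩, hmin⟩ := hZ.exists_isLeast ⟨b, right_mem_Icc.2 hb0,
      (min_le_left _ _ : min (g b) 1 ≤ g b)⟩
    have hsdom : (s, 0) ∈ φ.dom := hsub hs
    have hsol : (H.perturb δ).IsSolution ((φ.initialFlow s hsdom).steer d) := by
      refine (hφ.initialFlow hsdom).steer hL.le hC hdL (fun j t ht hm => ?_)
        (fun t j _ h => absurd h.2 (Nat.succ_ne_zero j))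
      have hj : j = 0 := (interior_subset ht : t ∈ (φ.initialFlow s hsdom).slice j).2
      subst hj
      have ht' : t ∈ Ioo 0 s := by
        rw [← interior_Icc]
        exact interior_mono (fun u hu => hu.1) ht
      refine estF t 0 ht'.1.le (Metric.thickening_subset_cthickening _ _ ?_) hm
      rw [Metric.mem_thickening_iff_infDist_lt hne]
      by_contra! hge
      exact absurd (hmin ⟨⟨ht'.1.le, ht'.2.le.trans hs.2⟩, (min_le_right _ _).trans hge⟩)
        (not_le.2 ht'.2)
    have hmem : (φ.steer d).val s 0 ∈ I :=
      hx.2 _ hsol hψ0 ⟨s, 0, ⟨right_mem_Icc.2 hs.1, rfl⟩, rfl⟩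
    have hg0 : g s = 0 := Metric.infDist_zero_of_mem hmem
    have : min (g b) 1 ≤ g s := hgs
    exact absurd (lt_min hgb one_pos) (by linarith)
  -- After the first jump the steered arc is `φ` itself, so the inclusions are trivial, wherever the
  -- arc is.
  have hpos : ∀ t j, 0 ≤ t → j ≠ 0 → (φ.steer d).val t j = φ.val t j := by
    intro t j ht hj
    refine φ.steer_val_eq d ?_
    have : (1 : ℝ) ≤ j := by exact_mod_cast Nat.one_le_iff_ne_zero.2 hj
    linarith
  have hself : ∀ S : Set (State n), S ⊆ S + Metric.closedBall 0 (L * ‖d‖) := fun S v hv =>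
    Set.mem_add.2 ⟨v, hv, 0, Metric.mem_closedBall_self (by positivity), add_zero v⟩
  refine hφ.steer hL.le hC hdL (fun j t ht hm => ?_) (fun t j h1 _ hm => ?_)
  · have hdom : (t, j) ∈ φ.dom := (interior_subset ht : t ∈ φ.slice j)
    have ht0 := φ.nonneg_of_mem_dom hdom
    by_cases hj : j = 0
    · subst hj
      exact estF t 0 ht0 (Metric.self_subset_cthickening I (hstay t hdom)) hm
    · rw [hpos t j ht0 hj]
      exact hself _
  · have ht0 := φ.nonneg_of_mem_dom h1
    by_cases hj : j = 0
    · subst hj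
      exact estG t 0 ht0 (hstay t h1) hm
    · rw [hpos t j ht0 hj]
      exact hself _

/-! ### Stability of the closed staying set -/

/-- Uniform pre-asymptotic stability of the staying set of `H_δ` for the systems `H_δ'` with a
smaller perturbation. -/
theorem upAS_closure_stayingSet {δ δ' : ℝ} (hδ : δ' < δ) (hC : IsClosed H.C) (hD : IsClosed H.D)
    (hF : ∃ O : Set (State n), IsOpen O ∧ (H.perturb δ).C ⊆ O ∧
      SetValuedLocallyLipschitzOn H.F O)
    (hG : ∃ O : Set (State n), IsOpen O ∧ (H.perturb δ).D ⊆ O ∧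
      SetValuedLocallyLipschitzOn H.G O)
    {I : Set (State n)} (hI : IsCompact I) :
    (H.perturb δ').UpAS (closure ((H.perturb δ).stayingSet I)) := by
  obtain ⟨r, hr, hsteer⟩ := exists_steering_radius hδ hC hD hF hG hI
  have near : ∀ (φ : HybridArc n) (η : ℝ), Metric.infEDist (φ.val 0 0)
      (closure ((H.perturb δ).stayingSet I)) < ENNReal.ofReal η →
      ∃ x ∈ (H.perturb δ).stayingSet I, ‖x - φ.val 0 0‖ < η := by
    intro φ η h
    rw [Metric.infEDist_closure] at h
    obtain ⟨x, hx, hlt⟩ := Metric.infEDist_lt_iff.1 h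
    rw [edist_comm, edist_lt_ofReal, dist_eq_norm] at hlt
    exact ⟨x, hx, hlt⟩
  have steered : ∀ φ, (H.perturb δ').IsSolution φ → ∀ x ∈ (H.perturb δ).stayingSet I,
      ‖x - φ.val 0 0‖ < r → ∀ t j, (t, j) ∈ φ.dom →
      (φ.steer (x - φ.val 0 0)).val t j ∈ (H.perturb δ).stayingSet I := by
    intro φ hφ x hx hlt t j h
    refine (hsteer φ hφ x hx hlt).mem_stayingSet (isClosed_perturb_C hC δ) ?_ h
    rw [φ.steer_val_zero]
    simpa using hx
  -- The steered arc stays in the staying set within `‖d‖` of `φ`, whence `η = min ε r`; it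
  -- coincides with `φ` from hybrid time 1 on, so `T = 1` serves every `ε`.
  refine ⟨isClosed_closure, fun ε hε => ⟨min ε r, lt_min hε hr, fun φ hφ h t j hdom => ?_⟩,
    r, hr, fun ε hε => ⟨1, one_pos, fun φ hφ h t j hdom hT => ?_⟩⟩
  · obtain ⟨x, hx, hlt⟩ := near φ _ h
    have hm := steered φ hφ x hx (hlt.trans_le (min_le_right _ _)) t j hdom
    rw [Metric.infEDist_closure]
    refine (Metric.infEDist_le_edist_of_mem hm).trans_lt ?_
    rw [edist_comm, edist_lt_ofReal, dist_eq_norm]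
    exact (φ.norm_steer_val_sub_le _ (φ.nonneg_of_mem_dom hdom) j).trans_lt
      (hlt.trans_le (min_le_left _ _))
  · obtain ⟨x, hx, hlt⟩ := near φ _ h
    have hm := steered φ hφ x hx hlt t j hdom
    rw [φ.steer_val_eq _ hT] at hm
    rw [Metric.infEDist_zero_of_mem (subset_closure hm)]
    exact ENNReal.ofReal_pos.2 hε

/-! ### Reaching the staying set from the initial set -/

/-- Solutions of `H` from `X₀` reach the staying set of `I` within a uniform time. -/
theorem IsSolution.mem_stayingSet_of_reach (hC : IsClosed H.C) {X₀ I : Set (State n)} {T : ℝ}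
    (hT : H.reachGE T X₀ ⊆ I) {φ : HybridArc n} (hφ : H.IsSolution φ) (h0 : φ.val 0 0 ∈ X₀)
    {t : ℝ} {j : ℕ} (h : (t, j) ∈ φ.dom) (htj : T ≤ t + (j : ℝ)) :
    φ.val t j ∈ H.stayingSet I := by
  -- `reachGE` concerns maximal solutions only; an arbitrary solution is first extended.
  have reach : ∀ ω, H.IsSolution ω → ω.val 0 0 ∈ X₀ → ∀ s k, (s, k) ∈ ω.dom →
      T ≤ s + (k : ℝ) → ω.val s k ∈ I := by
    intro ω hω hω0 s k hs hsk
    obtain ⟨Ω, hΩ, hext⟩ := hω.exists_maximal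
    refine hT ⟨Ω, ⟨hΩ, ?_⟩, s, k, hext.1 hs, hsk, (hext.2 s k hs).symm⟩
    rwa [hext.val_zero]
  refine ⟨reach φ hφ h0 t j h htj, fun χ hχ hval => ?_⟩
  rintro _ ⟨s, k, hs, rfl⟩
  obtain ⟨ω, hω, hω0, hωχ⟩ := hφ.exists_concat hC hχ h hval
  obtain ⟨hm, he⟩ := hωχ s k hs
  rw [← he]
  refine reach ω hω (hω0 ▸ h0) _ _ hm ?_
  push_cast
  linarith [χ.nonneg_of_mem_dom hs, (Nat.cast_nonneg k : (0 : ℝ) ≤ k)]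

/-- Completeness supplies a time of the domain beyond `T`: before it the arc is bounded, after it
the arc is in `I`. -/
theorem isBdd_of_isComplete_of_reach {X₀ I : Set (State n)} (hI : Bornology.IsBounded I) {T : ℝ}
    (hT : H.reachGE T X₀ ⊆ I) {φ : HybridArc n} (hφ : φ ∈ H.maximalSolutions X₀)
    (hc : φ.IsComplete) : φ.IsBdd := by
  obtain ⟨t₀, j₀, h₀, hle⟩ := hc T
  refine ((φ.isBounded_before h₀).union hI).subset ?_
  rintro _ ⟨t, j, h, rfl⟩
  by_cases hlt : t + (j : ℝ) < t₀ + (j₀ : ℝ)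
  · exact Or.inl ⟨t, j, h, hlt, rfl⟩
  · exact Or.inr (hT ⟨φ, hφ, t, j, h, hle.trans (not_lt.1 hlt), rfl⟩)

end HybridSystem

/-! ### The proposition -/

theorem mainTheorem4 {n : ℕ} (H : HybridSystem n) (hH : H.BasicConditions)
    (δ : ℝ) (hδ : 0 ≤ δ)
    (hF : ∃ O : Set (State n), IsOpen O ∧ (H.perturb δ).C ⊆ O ∧
      SetValuedLocallyLipschitzOn H.F O)
    (hG : ∃ O : Set (State n), IsOpen O ∧ (H.perturb δ).D ⊆ O ∧
      SetValuedLocallyLipschitzOn H.G O)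
    (X₀ U I : Set (State n)) (hX₀ : X₀.Nonempty) (hI : IsCompact I)
    (hbc : ∀ φ ∈ (H.perturb δ).maximalSolutions X₀, φ.IsBdd ∨ φ.IsComplete)
    (hras : (H.perturb δ).ReachAvoidStay X₀ U I) :
    ∃ A : Set (State n), A ⊆ I ∧ IsCompact A ∧
      ∀ δ' : ℝ, 0 ≤ δ' → δ' < δ → (H.perturb δ').StableSafe X₀ U A := by
  obtain ⟨⟨T, -, hT⟩, hsafe⟩ := hras
  have hAI : closure ((H.perturb δ).stayingSet I) ⊆ I :=
    closure_minimal (fun x hx => hx.1) hI.isClosed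
  refine ⟨closure ((H.perturb δ).stayingSet I), hAI,
    hI.of_isClosed_subset isClosed_closure hAI, fun δ' _ hδ' => ⟨⟨?_, ?_⟩, ?_⟩⟩
  · exact HybridSystem.upAS_closure_stayingSet hδ' hH.isClosed_C hH.isClosed_D hF hG hI
  · rintro x hx φ hφ rfl
    have hφδ := hφ.perturb_mono hδ'.le
    -- After the reach time `T` the distance to `A` is 0, so one `T` serves every `ε`.
    refine ⟨?_, fun _ ε hε => ⟨T, fun t j h htj => ?_⟩⟩
    · obtain ⟨Φ, hΦ, hext⟩ := hφδ.exists_maximal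
      have hΦm : Φ ∈ (H.perturb δ).maximalSolutions X₀ := ⟨hΦ, by rwa [hext.val_zero]⟩
      have hbdd : Φ.IsBdd := (hbc Φ hΦm).elim id
        (HybridSystem.isBdd_of_isComplete_of_reach hI.isBounded hT hΦm)
      refine Bornology.IsBounded.subset hbdd ?_
      rintro _ ⟨t, j, h, rfl⟩
      exact ⟨t, j, hext.1 h, (hext.2 t j h).symm⟩
    · have hm := hφδ.mem_stayingSet_of_reach
        (HybridSystem.isClosed_perturb_C hH.isClosed_C δ) hT hx h htj
      rw [Metric.infEDist_zero_of_mem (subset_closure hm)]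
      exact ENNReal.ofReal_pos.2 hε
  · rintro φ ⟨hφ, h0⟩
    -- Maximality for `δ'` need not persist for `δ`, where more continuations exist; the safe arc is
    -- a maximal extension.
    obtain ⟨Φ, hΦ, hext⟩ := (hφ.1.perturb_mono hδ'.le).exists_maximal
    have hΦU := hsafe Φ ⟨hΦ, by rwa [hext.val_zero]⟩
    refine eq_empty_iff_forall_notMem.2 ?_
    rintro _ ⟨⟨t, j, h, rfl⟩, hU⟩
    have : φ.val t j ∈ Φ.rge ∩ U := ⟨⟨t, j, hext.1 h, (hext.2 t j h).symm⟩, hU⟩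
    rw [hΦU] at this
    exact this
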